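/- Let $\mathcal L_{\mathrm{ri}}=\{+,\cdot,-,0,1\}$ be the language of unital rings, let $n\ge 1$, and let $F$ be a (commutative) field. Let $\tilde F$ be an expansion of $F$ in some first-order language $\mathcal L$ extending $\mathcal L_{\mathrm{ri}}$. Let $M_n(\tilde F)$ be the $\mathcal L$-structure that expands the ring $M_n(F)$ of $n\times n$ matrices as follows, where the center $C=F\cdot I_n$ of $M_n(F)$ is identified with $F$ via $a\mapsto a I_n$: every symbol of $\mathcal L\setminus\mathcal L_{\mathrm{ri}}$ that is a relation symbol is interpreted by the relation on $C$ given by $\tilde F$ (so it holds only for tuples from $C$); every constant symbol is interpreted by the element of $C$ given by $\tilde F$; and every $m$-ary function symbol is interpreted on $C^m$ by the function given by $\tilde F$ and takes the value $0$ on all tuples outside $C^m$. A tuple of matrix units in $M_n(F)$ is a tuple $\bar e=(e_{ij})_{1\le i,j\le n}$ of elements of $M_n(F)$ such that, for all $i,j,s,t$, $e_{ij}\ne 0$, $e_{ij}e_{jt}=e_{it}$, and $e_{ij}e_{st}=0$ if $j\ne s$. A structure has quantifier elimination if every formula $\varphi(\bar x)$ of its language is equivalent in the structure to a quantifier-free formula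 $\psi(\bar x)$ in the same free variables. Suppose that $\tilde F$ has quantifier elimination in $\mathcal L$. Let $\bar c=(c_{ij})_{1\le i,j\le n}$ be new constant symbols and let $\bar e$ be any tuple of matrix units in $M_n(F)$. Then the $\mathcal L(\bar c)$-structure $(M_n(\tilde F),\bar e)$, in which $c_{ij}$ is interpreted by $e_{ij}$, has quantifier elimination. In particular, for every $n\ge 1$, the ring $M_n(\mathbb C)$ expanded by constants for the standard matrix units $E_{ij}$ has quantifier elimination, and the ring $M_n(\mathbb R)$ expanded by the natural order on its center $\mathbb R\cdot I_n$ and by constants for the standard matrix units $E_{ij}$ has quantifier elimination. -/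

import Mathlib

universe u v w

namespace MatrixQE

/-- A first-order structure has quantifier elimination: every formula in finitely many free
variables is equivalent, in the structure, to a quantifier-free formula in the same variables. -/
def HasQE {L : FirstOrder.Language.{u, v}} {M : Type w} (S : L.Structure M) : Prop :=
  letI := S
  ∀ (k : ℕ) (φ : L.Formula (Fin k)), ∃ ψ : L.Formula (Fin k),
    ψ.IsQF ∧ ∀ x : Fin k → M, φ.Realize x ↔ ψ.Realize x

/-- A ring as a structure in the language `{+, ·, -, 0, 1}` of unital rings. -/
abbrev ringStructure (R : Type w) [Ring R] : FirstOrder.Language.ring.Structure R :=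
  (FirstOrder.Ring.compatibleRingOfRing R).toStructure

/-- The expansion of a ring `R` by the interpretation `S` of a language `L` of new symbols.
A language extending the language of rings is the disjoint union of the language of rings and the
language of its new symbols. -/
abbrev ringExpansion {L : FirstOrder.Language.{u, v}} (R : Type w) [Ring R] (S : L.Structure R) :
    (FirstOrder.Language.ring.sum L).Structure R :=
  letI := ringStructure R
  letI := S
  FirstOrder.Language.sumStructure FirstOrder.Language.ring L R

/-- `a` is the tuple of field elements corresponding to the tuple `A` of central elements of the
matrix ring. The center of the matrix ring consists of the scalar matrices and it is identified
with the field via `a ↦ a • I`. -/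
def IsCentralTuple {F : Type w} [Field F] {n k : ℕ}
    (A : Fin k → Matrix (Fin n) (Fin n) F) (a : Fin k → F) : Prop :=
  ∀ i, A i = Matrix.scalar (Fin n) (a i)

open Classical in
/-- The interpretation of the new symbols on `n × n` matrices: a relation symbol holds only for
tuples of central elements, as given by the field; a function symbol is on tuples of central
elements as given by the field, and `0` on all other tuples. -/
noncomputable abbrev centerStructure {L : FirstOrder.Language.{u, v}} {F : Type w} [Field F]
    (S : L.Structure F) (n : ℕ) : L.Structure (Matrix (Fin n) (Fin n) F) where
  funMap f A :=
    if h : ∃ a, IsCentralTuple A a then Matrix.scalar (Fin n) (S.funMap f h.choose) else 0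
  RelMap R A := ∃ a, IsCentralTuple A a ∧ S.RelMap R a

/-- The structure on `n × n` matrices over an expansion of a field `F`, where `S` is the
interpretation in `F` of the new symbols. -/
noncomputable abbrev matrixExpansion {L : FirstOrder.Language.{u, v}} {F : Type w} [Field F]
    (S : L.Structure F) (n : ℕ) :
    (FirstOrder.Language.ring.sum L).Structure (Matrix (Fin n) (Fin n) F) :=
  ringExpansion (Matrix (Fin n) (Fin n) F) (centerStructure S n)

/-- The expansion of a structure by new constant symbols `c i j`, interpreted by `e i j`. -/
abbrev nameConstants {L : FirstOrder.Language.{u, v}} {M : Type w} (S : L.Structure M) {n : ℕ}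
    (e : Fin n → Fin n → M) : (L.withConstants (Fin n × Fin n)).Structure M :=
  letI := S
  letI := FirstOrder.Language.constantsOn.structure fun p : Fin n × Fin n => e p.1 p.2
  FirstOrder.Language.sumStructure L (FirstOrder.Language.constantsOn (Fin n × Fin n)) M

/-- A tuple of `n × n` matrix units in a ring. -/
structure IsMatrixUnits {R : Type w} [Ring R] {n : ℕ} (e : Fin n → Fin n → R) : Prop where
  mul_same : ∀ i j t, e i j * e j t = e i t
  mul_of_ne : ∀ i j s t, j ≠ s → e i j * e s t = 0
  ne_zero : ∀ i j, e i j ≠ 0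

/-- The standard matrix units `E i j`. -/
abbrev stdUnits (F : Type w) [Field F] (n : ℕ) (i j : Fin n) : Matrix (Fin n) (Fin n) F :=
  Matrix.single i j 1

end MatrixQE

namespace MatrixQE

open Polynomial

/-! ### Finite families of polynomials -/

/-! Matrix units form an `F`-basis of the matrix ring, since `e i i * A * e j j` isolates one
coordinate of `A`. The ring operations are polynomial in the coordinates, and the new symbols act by
a case distinction on whether the coordinates describe scalar matrices. So the matrix structure is
interpreted in `F`: a formula about matrices becomes a formula of `F` about their coordinates, and
quantifier elimination in `F` makes it quantifier-free. The named matrix units allow the way back: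
`∑ t, e t i * A * e j t` is the scalar matrix of the `(i, j)` coordinate of `A`
(`IsMatrixUnits.sum_mul_mul`), so coordinates are values of terms. As `a ↦ a • I` embeds `F` with
all its symbols (`scalarEmbedding`), a quantifier-free formula has the same truth value at the
coordinates in `F` and at these scalar matrices. This is `hasQE_of_coordinates`, applied in
`hasQE_matrix`.

For `ℂ` and `ℝ` it remains to eliminate quantifiers in the field. By `hasQE_of_patterns` it suffices
that the patterns of zeros (over `ℂ`) or of signs (over `ℝ`) which finitely many one-variable
polynomials can realize depend only on finitely many such data of their coefficients. Both cases use
induction on the multiset of degrees, erasing leading terms that vanish and replacing a polynomial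
of maximal degree by pseudo-remainders.

Over an algebraically closed field (`exists_finset_zero_pattern`) this leads to a single equation `f
= 0` with a condition `g ≠ 0`, which is solvable exactly when `f` does not divide `g ^ deg f`. Over
`ℝ` (`exists_finset_sign_table`) the signs of `p` at the roots of the other polynomials and of `p'`
are read off from remainders. Between consecutive such points `p` is strictly monotone, so these
signs determine where its roots lie. The comparison of two specializations is recorded by an order
automorphism of the line that matches all signs. -/

/-- Replacing one polynomial by any finite number of polynomials of smaller degree lowers the
multiset of degrees in the Dershowitz–Manna order, which is well-founded. -/
theorem multiset_polynomial_induction {A : Type*} [Semiring A] {P : Multiset A[X] → Prop}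
    (step : ∀ L, (∀ p Q R, L = p ::ₘ Q → (∀ r ∈ R, r.degree < p.degree) → P (R + Q)) → P L)
    (L : Multiset A[X]) : P L := by
  have wf := InvImage.wf (fun L : Multiset A[X] => L.map degree)
    (Multiset.wellFounded_isDershowitzMannaLT (α := WithBot ℕ))
  induction L using wf.induction with
  | _ L ih =>
    refine step L fun p Q R hL hR => ih _ ⟨Q.map degree, R.map degree, {p.degree}, ?_, ?_, ?_, ?_⟩
    · simp
    · exact (Multiset.map_add _ _ _).trans (add_comm _ _)
    · rw [hL, add_comm, Multiset.singleton_add]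
      exact Multiset.map_cons _ _ _
    · simpa using hR

/-- Multiplying by powers of the leading coefficient avoids division in `A`, so the identity
survives every ring homomorphism out of `A`. -/
theorem exists_pseudo_division {A : Type*} [CommRing A] [IsDomain A] (p q : A[X]) :
    ∃ (k : ℕ) (s r : A[X]), C (q.leadingCoeff ^ k) * p = s * q + r ∧
      (r = 0 ∨ r.degree < q.degree) := by
  rcases eq_or_ne q 0 with rfl | hq
  · exact ⟨1, 0, 0, by simp, Or.inl rfl⟩
  have wf := InvImage.wf (fun p : A[X] => p.degree) (wellFounded_lt (α := WithBot ℕ))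
  induction p using wf.induction with
  | _ p ih =>
    by_cases hpq : p.degree < q.degree
    · exact ⟨0, 0, p, by simp, Or.inr hpq⟩
    rw [not_lt] at hpq
    have hp : p ≠ 0 := by
      rintro rfl
      rw [degree_zero, le_bot_iff, degree_eq_bot] at hpq
      exact hq hpq
    have hq' : q.leadingCoeff ≠ 0 := leadingCoeff_ne_zero.2 hq
    have hp' : p.leadingCoeff ≠ 0 := leadingCoeff_ne_zero.2 hp
    have hn : q.natDegree ≤ p.natDegree := natDegree_le_natDegree hpq
    have h1 : (C q.leadingCoeff * p).degree = p.degree := degree_C_mul hq'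
    have hlt : (C q.leadingCoeff * p -
        C p.leadingCoeff * X ^ (p.natDegree - q.natDegree) * q).degree < p.degree := by
      rw [← h1]
      refine degree_sub_lt_left ?_ (mul_ne_zero (C_ne_zero.2 hq') hp) ?_
      · rw [h1, degree_mul, degree_C_mul hp', degree_X_pow, degree_eq_natDegree hp,
          degree_eq_natDegree hq]
        norm_cast
        omega
      · rw [leadingCoeff_mul, leadingCoeff_mul, leadingCoeff_mul, leadingCoeff_C, leadingCoeff_C,
          leadingCoeff_X_pow, mul_one, mul_comm]
    obtain ⟨k, s, r, h, hr⟩ := ih _ hlt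
    refine ⟨k + 1, s + C (q.leadingCoeff ^ k) * (C p.leadingCoeff *
      X ^ (p.natDegree - q.natDegree)), r, ?_, hr⟩
    rw [pow_succ, C_mul]
    linear_combination h

/-! ### Polynomial functions on the real line -/

theorem eval_pos_of_forall_ne_zero {g : ℝ → ℝ} (hg : Continuous g) {a b : ℝ}
    (h : ∀ t ∈ Set.uIcc a b, g t ≠ 0) (ha : 0 < g a) : 0 < g b := by
  by_contra hb
  rw [not_lt] at hb
  obtain ⟨t, ht, h0⟩ := intermediate_value_uIcc (hg.continuousOn (s := Set.uIcc a b))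
    (Set.mem_uIcc.2 (Or.inr ⟨hb, ha.le⟩) : (0 : ℝ) ∈ Set.uIcc (g a) (g b))
  exact h t ht h0

theorem sign_eq_of_forall_ne_zero {g : ℝ → ℝ} (hg : Continuous g) {a b : ℝ}
    (h : ∀ t ∈ Set.uIcc a b, g t ≠ 0) : SignType.sign (g a) = SignType.sign (g b) := by
  rcases lt_or_gt_of_ne (h a Set.left_mem_uIcc) with ha | ha
  · have := eval_pos_of_forall_ne_zero hg.neg (a := a) (b := b) (fun t ht => neg_ne_zero.2 (h t ht))
      (neg_pos.2 ha)
    rw [sign_neg ha, sign_neg (neg_pos.1 this)]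
  · rw [sign_pos ha, sign_pos (eval_pos_of_forall_ne_zero hg h ha)]

theorem eval_lt_eval_of_derivative_pos (p : ℝ[X]) {a b : ℝ} (hab : a < b)
    (h : ∀ t ∈ Set.Ioo a b, 0 < p.derivative.eval t) : p.eval a < p.eval b := by
  have := strictMonoOn_of_deriv_pos (convex_Icc a b) p.continuous.continuousOn
    (fun t ht => by rw [Polynomial.deriv]; rw [interior_Icc] at ht; exact h t ht)
  exact this (Set.left_mem_Icc.2 hab.le) (Set.right_mem_Icc.2 hab.le) hab

/-- A nonconstant polynomial is unbounded in absolute value, and one that increases beyond `c`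
cannot achieve this with nonpositive values. -/
theorem exists_ge_eval_pos (p : ℝ[X]) (hp : 0 < p.natDegree) {c : ℝ}
    (h : ∀ t, c ≤ t → 0 < p.derivative.eval t) : ∃ t, c ≤ t ∧ 0 < p.eval t := by
  have hlim := p.abs_tendsto_atTop (natDegree_pos_iff_degree_pos.1 hp)
  obtain ⟨t, ht, hct⟩ := ((hlim.eventually_gt_atTop |p.eval c|).and
    (Filter.eventually_gt_atTop c)).exists
  refine ⟨t, hct.le, ?_⟩
  have hlt := eval_lt_eval_of_derivative_pos p hct fun s hs => h s hs.1.le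
  by_contra hneg
  rw [not_lt] at hneg
  rw [abs_of_nonpos hneg, abs_of_nonpos (hlt.le.trans hneg)] at ht
  linarith

theorem exists_le_eval_neg (p : ℝ[X]) (hp : 0 < p.natDegree) {c : ℝ}
    (h : ∀ t, t ≤ c → 0 < p.derivative.eval t) : ∃ t, t ≤ c ∧ p.eval t < 0 := by
  obtain ⟨t, ht, h0⟩ := exists_ge_eval_pos (-(p.comp (-X))) (c := -c)
    (by simpa [natDegree_comp] using hp)
    (fun t ht => by simpa [derivative_comp] using h (-t) (by linarith))
  exact ⟨-t, by linarith, by simpa using h0⟩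

/-! ### Order automorphisms of the real line -/

/-- Keep `h` up to `a` and continue along the line through `(a, h a)` and `(m, b)`, whose slope is
positive. -/
theorem exists_orderIso_eqOn_Iic (h : ℝ ≃o ℝ) {a m b : ℝ} (ham : a < m) (hb : h a < b) :
    ∃ h' : ℝ ≃o ℝ, (∀ x ≤ a, h' x = h x) ∧ h' m = b := by
  set c := (b - h a) / (m - a) with hc
  have hc0 : 0 < c := div_pos (by linarith) (by linarith)
  let f : ℝ → ℝ := fun x => if x ≤ a then h x else h a + c * (x - a)
  have hmono : StrictMono f := by
    intro x y hxy
    simp only [f]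
    split_ifs with hx hy hy
    · exact h.strictMono hxy
    · have := h.monotone hx
      nlinarith
    · linarith
    · nlinarith
  have hsurj : Function.Surjective f := by
    intro z
    rcases le_or_gt z (h a) with hz | hz
    · refine ⟨h.symm z, ?_⟩
      have : h.symm z ≤ a := by rwa [OrderIso.symm_apply_le]
      simp [f, this]
    · refine ⟨a + (z - h a) / c, ?_⟩
      have : ¬ a + (z - h a) / c ≤ a := by
        have : 0 < (z - h a) / c := div_pos (by linarith) hc0
        linarith
      simp only [f, this, if_false]
      field_simp
      ring
  refine ⟨hmono.orderIsoOfSurjective f hsurj, fun x hx => ?_, ?_⟩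
  · simp [f, hx]
  · have : m - a ≠ 0 := by linarith
    simp only [StrictMono.coe_orderIsoOfSurjective, f, not_le.2 ham, if_false, hc]
    field_simp
    ring

theorem exists_orderIso_of_strictMonoOn (S : Finset ℝ) (f : ℝ → ℝ) (hf : StrictMonoOn f S) :
    ∃ h : ℝ ≃o ℝ, ∀ s ∈ S, h s = f s := by
  induction S using Finset.induction_on_max with
  | empty => exact ⟨OrderIso.refl ℝ, by simp⟩
  | insert m S hm ih =>
    obtain ⟨h, hh⟩ := ih (hf.mono (by simp))
    rcases S.eq_empty_or_nonempty with rfl | hne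
    · exact ⟨OrderIso.addRight (f m - m), by simp⟩
    have ha := S.max'_mem hne
    obtain ⟨h', h1, h2⟩ := exists_orderIso_eqOn_Iic h (hm _ ha) (b := f m) (by
      rw [hh _ ha]
      exact hf (by simp [ha]) (by simp) (hm _ ha))
    refine ⟨h', fun s hs => ?_⟩
    rcases Finset.mem_insert.1 hs with rfl | hs
    · exact h2
    · rw [h1 s (S.le_max' s hs), hh s hs]

/-! ### Transfer of signs from the critical points -/

/-- `h` matches the signs of the derivatives of `p` and `q`, and those of `p` and `q` themselves
at the points of a finite set `Z` that contains the critical points of `p`. -/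
structure SignPair (h : ℝ ≃o ℝ) (Z : Finset ℝ) (p q : ℝ[X]) : Prop where
  natDegree_left : 0 < p.natDegree
  natDegree_right : 0 < q.natDegree
  sign_derivative : ∀ y, SignType.sign (p.derivative.eval y) =
    SignType.sign (q.derivative.eval (h y))
  mem_of_critical : ∀ y, p.derivative.eval y = 0 → y ∈ Z
  sign_eq : ∀ z ∈ Z, SignType.sign (p.eval z) = SignType.sign (q.eval (h z))

/-- `y` and `t` have the same position with respect to the points of `Z`. -/
def SameCell (Z : Finset ℝ) (y t : ℝ) : Prop :=
  ∀ z ∈ Z, (z < y ↔ z < t) ∧ (y < z ↔ t < z)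

theorem SameCell.trans {Z : Finset ℝ} {x y t : ℝ} (h : SameCell Z x y) (h' : SameCell Z y t) :
    SameCell Z x t :=
  fun z hz => ⟨(h z hz).1.trans (h' z hz).1, (h z hz).2.trans (h' z hz).2⟩

theorem SameCell.symm {Z : Finset ℝ} {y t : ℝ} (h : SameCell Z y t) : SameCell Z t y :=
  fun z hz => ⟨(h z hz).1.symm, (h z hz).2.symm⟩

theorem SameCell.notMem {Z : Finset ℝ} {y t : ℝ} (h : SameCell Z y t) (hy : y ∉ Z) : t ∉ Z := by
  intro ht
  have := h t ht
  simp only [lt_irrefl, iff_false, not_lt] at this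
  exact hy (le_antisymm this.1 this.2 ▸ ht)

theorem SameCell.of_mem_uIcc {Z : Finset ℝ} {x y t : ℝ} (hy : SameCell Z x y)
    (ht : t ∈ Set.uIcc x y) : SameCell Z x t := by
  intro z hz
  obtain ⟨h1, h2⟩ := hy z hz
  rcases Set.mem_uIcc.1 ht with ⟨h3, h4⟩ | ⟨h3, h4⟩ <;> grind

theorem SameCell.of_lt_of_lt {Z : Finset ℝ} {y t : ℝ} (hy : y ∉ Z) (h1 : ∀ z ∈ Z, z < y → z < t)
    (h2 : ∀ z ∈ Z, y < z → t < z) : SameCell Z y t := by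
  intro z hz
  have := h1 z hz
  have := h2 z hz
  have : z ≠ y := fun h => hy (h ▸ hz)
  grind

namespace SignPair

variable {h : ℝ ≃o ℝ} {Z : Finset ℝ} {p q : ℝ[X]}

theorem symm (H : SignPair h Z p q) : SignPair h.symm (Z.map h.toEquiv.toEmbedding) q p where
  natDegree_left := H.natDegree_right
  natDegree_right := H.natDegree_left
  sign_derivative y := by rw [H.sign_derivative, h.apply_symm_apply]
  mem_of_critical y hy := by
    refine Finset.mem_map.2 ⟨h.symm y, H.mem_of_critical _ ?_, h.apply_symm_apply y⟩
    rw [← sign_eq_zero_iff, H.sign_derivative, h.apply_symm_apply, hy, sign_zero]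
  sign_eq z hz := by
    obtain ⟨x, hx, rfl⟩ := Finset.mem_map.1 hz
    have := H.sign_eq x hx
    simp [this]

/-- Allows the arguments below to treat only cells on which `p` increases. -/
theorem neg (H : SignPair h Z p q) : SignPair h Z (-p) (-q) where
  natDegree_left := by simpa using H.natDegree_left
  natDegree_right := by simpa using H.natDegree_right
  sign_derivative y := by simpa [Left.sign_neg] using H.sign_derivative y
  mem_of_critical y hy := H.mem_of_critical y (by simpa using hy)
  sign_eq z hz := by simpa [Left.sign_neg] using H.sign_eq z hz

/-- All critical points lie in `Z`, so the derivative keeps its sign on a cell that avoids `Z`. -/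
theorem derivative_pos (H : SignPair h Z p q) {y t : ℝ} (hy : y ∉ Z)
    (hpos : 0 < p.derivative.eval y) (hc : SameCell Z y t) : 0 < p.derivative.eval t :=
  eval_pos_of_forall_ne_zero p.derivative.continuous
    (fun _ hs h0 => (hc.of_mem_uIcc hs).notMem hy (H.mem_of_critical _ h0)) hpos

theorem derivative_pos_right (H : SignPair h Z p q) {y : ℝ} :
    0 < q.derivative.eval (h y) ↔ 0 < p.derivative.eval y := by
  rw [← sign_eq_one_iff, ← sign_eq_one_iff, H.sign_derivative]

theorem lt_left (H : SignPair h Z p q) {y s t : ℝ} (hy : y ∉ Z)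
    (hpos : 0 < p.derivative.eval y) (hs : SameCell Z y s) (ht : SameCell Z y t) (hst : s < t) :
    p.eval s < p.eval t := by
  refine eval_lt_eval_of_derivative_pos p hst fun x hx => H.derivative_pos hy hpos ?_
  exact hs.trans ((hs.symm.trans ht).of_mem_uIcc (Set.mem_uIcc.2 (Or.inl ⟨hx.1.le, hx.2.le⟩)))

theorem lt_right (H : SignPair h Z p q) {y s t : ℝ} (hy : y ∉ Z)
    (hpos : 0 < p.derivative.eval y) (hs : SameCell Z y s) (ht : SameCell Z y t) (hst : s < t) :
    q.eval (h s) < q.eval (h t) := by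
  refine eval_lt_eval_of_derivative_pos q (h.strictMono hst) fun x hx => ?_
  obtain ⟨x, rfl⟩ := h.surjective x
  rw [Set.mem_Ioo, h.lt_iff_lt, h.lt_iff_lt] at hx
  refine H.derivative_pos_right.2 (H.derivative_pos hy hpos ?_)
  exact hs.trans ((hs.symm.trans ht).of_mem_uIcc (Set.mem_uIcc.2 (Or.inl ⟨hx.1.le, hx.2.le⟩)))

/-- If `Z` has a next point to the right of `y`, then `p` is positive there and the sign carries
over to `q`. Otherwise `q` increases on the whole remaining ray and becomes positive. The inequality
`t ≤ z` admits the end point of the cell. -/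
theorem exists_ge_pos (H : SignPair h Z p q) {y : ℝ} (hy : y ∉ Z)
    (hpos : 0 < p.derivative.eval y) (h0 : 0 ≤ p.eval y) :
    ∃ t, y ≤ t ∧ (∀ z ∈ Z, y < z → t ≤ z) ∧ 0 < q.eval (h t) := by
  by_cases hne : (Z.filter (y < ·)).Nonempty
  · set b := (Z.filter (y < ·)).min' hne with hb
    obtain ⟨hbZ, hyb⟩ := Finset.mem_filter.1 ((Z.filter (y < ·)).min'_mem hne)
    have hmin : ∀ z ∈ Z, y < z → b ≤ z := fun z hz hyz =>
      Finset.min'_le _ _ (Finset.mem_filter.2 ⟨hz, hyz⟩)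
    refine ⟨b, hyb.le, hmin, ?_⟩
    have hlt := eval_lt_eval_of_derivative_pos p hyb fun t ht => by
      refine H.derivative_pos hy hpos (SameCell.of_lt_of_lt hy ?_ ?_)
      · intro z _ hz
        exact hz.trans ht.1
      · intro z hz hyz
        exact ht.2.trans_le (hmin z hz hyz)
    rw [← sign_eq_one_iff, ← H.sign_eq _ hbZ, sign_eq_one_iff]
    exact h0.trans_lt hlt
  · have hno : ∀ z ∈ Z, ¬ y < z := fun z hz hyz => hne ⟨z, Finset.mem_filter.2 ⟨hz, hyz⟩⟩
    obtain ⟨t, ht, hq⟩ := exists_ge_eval_pos q H.natDegree_right (c := h y) fun t ht => by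
      obtain ⟨t, rfl⟩ := h.surjective t
      rw [h.le_iff_le] at ht
      refine H.derivative_pos_right.2 (H.derivative_pos hy hpos (SameCell.of_lt_of_lt hy ?_ ?_))
      · intro z _ hz
        exact hz.trans_le ht
      · intro z hz hyz
        exact absurd hyz (hno z hz)
    refine ⟨h.symm t, by rwa [h.le_symm_apply], fun z hz hyz => absurd hyz (hno z hz), by simpa⟩

theorem exists_le_neg (H : SignPair h Z p q) {y : ℝ} (hy : y ∉ Z)
    (hpos : 0 < p.derivative.eval y) (h0 : p.eval y ≤ 0) :
    ∃ t, t ≤ y ∧ (∀ z ∈ Z, z < y → z ≤ t) ∧ q.eval (h t) < 0 := by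
  by_cases hne : (Z.filter (· < y)).Nonempty
  · set b := (Z.filter (· < y)).max' hne with hb
    obtain ⟨hbZ, hyb⟩ := Finset.mem_filter.1 ((Z.filter (· < y)).max'_mem hne)
    have hmax : ∀ z ∈ Z, z < y → z ≤ b := fun z hz hyz =>
      Finset.le_max' _ _ (Finset.mem_filter.2 ⟨hz, hyz⟩)
    refine ⟨b, hyb.le, hmax, ?_⟩
    have hlt := eval_lt_eval_of_derivative_pos p hyb fun t ht => by
      refine H.derivative_pos hy hpos (SameCell.of_lt_of_lt hy ?_ ?_)
      · intro z hz hyz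
        exact (hmax z hz hyz).trans_lt ht.1
      · intro z _ hz
        exact ht.2.trans hz
    rw [← sign_eq_neg_one_iff, ← H.sign_eq _ hbZ, sign_eq_neg_one_iff]
    exact hlt.trans_le h0
  · have hno : ∀ z ∈ Z, ¬ z < y := fun z hz hyz => hne ⟨z, Finset.mem_filter.2 ⟨hz, hyz⟩⟩
    obtain ⟨t, ht, hq⟩ := exists_le_eval_neg q H.natDegree_right (c := h y) fun t ht => by
      obtain ⟨t, rfl⟩ := h.surjective t
      rw [h.le_iff_le] at ht
      refine H.derivative_pos_right.2 (H.derivative_pos hy hpos (SameCell.of_lt_of_lt hy ?_ ?_))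
      · intro z hz hyz
        exact absurd hyz (hno z hz)
      · intro z _ hz
        exact ht.trans_lt hz
    refine ⟨h.symm t, by rwa [h.symm_apply_le], fun z hz hyz => absurd hyz (hno z hz), by simpa⟩

/-- `q ∘ h` is negative towards the left end of the cell and positive towards the right end, so the
intermediate value theorem gives a root strictly inside. -/
theorem exists_root_of_derivative_pos (H : SignPair h Z p q) {y : ℝ} (hy : y ∉ Z)
    (hpos : 0 < p.derivative.eval y) (h0 : p.eval y = 0) :
    ∃ t, SameCell Z y t ∧ q.eval (h t) = 0 := by
  obtain ⟨r, hr, hrZ, hr0⟩ := H.exists_ge_pos hy hpos h0.ge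
  obtain ⟨l, hl, hlZ, hl0⟩ := H.exists_le_neg hy hpos h0.le
  obtain ⟨t, ht, hqt⟩ := intermediate_value_Ioo (hl.trans hr)
    ((q.continuous.comp h.continuous).continuousOn) (⟨hl0, hr0⟩ : (0 : ℝ) ∈ Set.Ioo _ _)
  refine ⟨t, SameCell.of_lt_of_lt hy ?_ ?_, hqt⟩
  · intro z hz hzy
    exact (hlZ z hz hzy).trans_lt ht.1
  · intro z hz hzy
    exact ht.2.trans_le (hrZ z hz hzy)

theorem exists_root_right (H : SignPair h Z p q) {y : ℝ} (hy : y ∉ Z) (h0 : p.eval y = 0) :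
    ∃ t, SameCell Z y t ∧ q.eval (h t) = 0 := by
  have hne : p.derivative.eval y ≠ 0 := fun h => hy (H.mem_of_critical y h)
  rcases lt_or_gt_of_ne hne with hlt | hgt
  · obtain ⟨t, ht, hq⟩ := H.neg.exists_root_of_derivative_pos hy (by simpa using hlt)
      (by simpa using h0)
    exact ⟨t, ht, by simpa using hq⟩
  · exact H.exists_root_of_derivative_pos hy hgt h0

theorem exists_root_left (H : SignPair h Z p q) {y : ℝ} (hy : y ∉ Z) (h0 : q.eval (h y) = 0) :
    ∃ t, SameCell Z y t ∧ p.eval t = 0 := by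
  obtain ⟨t, ht, hp⟩ := H.symm.exists_root_right (y := h y) (by simpa using hy) h0
  refine ⟨h.symm t, fun z hz => ?_, hp⟩
  have := ht (h z) (Finset.mem_map_of_mem _ hz)
  rw [h.lt_iff_lt, h.lt_iff_lt] at this
  rwa [h.lt_symm_apply, h.symm_apply_lt]

/-- A root of `p` outside `Z` goes to a root of `q` in the corresponding cell, and points of `Z` go
where `h` sends them. -/
theorem exists_strictMonoOn (H : SignPair h Z p q) :
    ∃ f : ℝ → ℝ, StrictMonoOn f (Z ∪ p.roots.toFinset : Finset ℝ) ∧ (∀ z ∈ Z, f z = h z) ∧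
      ∀ w, p.eval w = 0 → q.eval (f w) = 0 := by
  have hp : p ≠ 0 := by
    rintro rfl
    simpa using H.natDegree_left
  have key : ∀ w, ∃ t, (w ∈ Z → t = w) ∧ (p.eval w = 0 → SameCell Z w t ∧ q.eval (h t) = 0) := by
    intro w
    by_cases hw : w ∈ Z
    · refine ⟨w, fun _ => rfl, fun h0 => ⟨fun _ _ => ⟨Iff.rfl, Iff.rfl⟩, ?_⟩⟩
      rw [← sign_eq_zero_iff, ← H.sign_eq w hw, h0, sign_zero]
    · by_cases h0 : p.eval w = 0
      · obtain ⟨t, ht⟩ := H.exists_root_right hw h0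
        exact ⟨t, fun h => absurd h hw, fun _ => ht⟩
      · exact ⟨w, fun _ => rfl, fun h => absurd h h0⟩
  choose g hg1 hg2 using key
  refine ⟨fun w => h (g w), ?_, fun z hz => congrArg h (hg1 z hz), fun w hw => (hg2 w hw).2⟩
  intro x hx y hy hxy
  rw [h.lt_iff_lt]
  simp only [Finset.coe_union, Set.mem_union, Finset.mem_coe, Multiset.mem_toFinset,
    mem_roots hp, IsRoot.def] at hx hy
  -- By Rolle's theorem a critical point, hence a point of `Z`, separates two roots of `p`, so their
  -- images lie in different cells in the right order.
  have between : ∀ x y, p.eval x = 0 → p.eval y = 0 → x < y → g x < g y := by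
    intro x y hx hy hxy
    obtain ⟨z, hz, hz0⟩ := exists_deriv_eq_zero hxy p.continuous.continuousOn (hx.trans hy.symm)
    rw [Polynomial.deriv] at hz0
    have hzZ := H.mem_of_critical z hz0
    exact (((hg2 x hx).1 z hzZ).2.1 hz.1).trans (((hg2 y hy).1 z hzZ).1.1 hz.2)
  rcases hx with hx | hx <;> rcases hy with hy | hy
  · rwa [hg1 x hx, hg1 y hy]
  · rw [hg1 x hx]
    exact ((hg2 y hy).1 x hx).1.1 hxy
  · rw [hg1 y hy]
    exact ((hg2 x hx).1 y hy).2.1 hxy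
  · exact between x y hx hy hxy

variable {h' : ℝ ≃o ℝ}

theorem sameCell_symm_apply (hZ : ∀ z ∈ Z, h' z = h z) (y : ℝ) :
    SameCell Z y (h.symm (h' y)) := by
  intro z hz
  rw [h.lt_symm_apply, h.symm_apply_lt, ← hZ z hz, h'.lt_iff_lt, h'.lt_iff_lt]
  exact ⟨Iff.rfl, Iff.rfl⟩

/-- On a cell where `p` increases, a root of `q` is the image of a root of `p`. -/
theorem exists_root_eq (H : SignPair h Z p q) (hZ : ∀ z ∈ Z, h' z = h z)
    (hroot : ∀ w, p.eval w = 0 → q.eval (h' w) = 0) {y v : ℝ} (hy : y ∉ Z)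
    (hpos : 0 < p.derivative.eval y) (hv : SameCell Z y v) (h0 : q.eval (h v) = 0) :
    ∃ w, SameCell Z y w ∧ p.eval w = 0 ∧ h' w = h v := by
  obtain ⟨w, hw, hpw⟩ := H.exists_root_left (hv.notMem hy) h0
  refine ⟨w, hv.trans hw, hpw, ?_⟩
  have hc := (hv.trans hw).trans (sameCell_symm_apply hZ w)
  have hq : q.eval (h (h.symm (h' w))) = 0 := by simpa using hroot w hpw
  rw [← h.symm_apply_eq]
  -- Both points are roots of `q ∘ h` in one cell, where this function is strictly increasing, so
  -- they coincide.
  rcases lt_trichotomy (h.symm (h' w)) v with hlt | heq | hgt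
  · have := H.lt_right hy hpos hc hv hlt
    rw [hq, h0] at this
    exact absurd this (lt_irrefl _)
  · exact heq
  · have := H.lt_right hy hpos hv hc hgt
    rw [hq, h0] at this
    exact absurd this (lt_irrefl _)

/-- A wrong sign of `q` at `h' y` would force a root of `q` on the wrong side of `h' y`. That root
is the `h'`-image of a root of `p` in the same cell, whose side of `y` is fixed by the monotonicity
of `p`. -/
theorem sign_eq_of_derivative_pos (H : SignPair h Z p q) (hZ : ∀ z ∈ Z, h' z = h z)
    (hroot : ∀ w, p.eval w = 0 → q.eval (h' w) = 0) {y : ℝ} (hy : y ∉ Z)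
    (hpos : 0 < p.derivative.eval y) :
    SignType.sign (p.eval y) = SignType.sign (q.eval (h' y)) := by
  have hcy := sameCell_symm_apply (h := h) hZ y
  obtain ⟨u, hu⟩ := h.surjective (h' y)
  rw [← hu, h.symm_apply_apply] at hcy
  have hcont : Continuous fun t => q.eval (h t) := q.continuous.comp h.continuous
  rcases lt_trichotomy (p.eval y) 0 with hlt | heq | hgt
  · rw [sign_neg hlt, eq_comm, sign_eq_neg_one_iff, ← hu]
    by_contra hge
    rw [not_lt] at hge
    obtain ⟨l, hl, hlZ, hl0⟩ := H.exists_le_neg hy hpos hlt.le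
    rcases lt_or_ge l u with hlu | hlu
    · obtain ⟨v, hv, hqv⟩ := intermediate_value_Ioc hlu.le hcont.continuousOn
        (⟨hl0, hge⟩ : (0 : ℝ) ∈ Set.Ioc _ _)
      obtain ⟨w, hw, hpw, hwv⟩ := H.exists_root_eq hZ hroot hy hpos (SameCell.of_lt_of_lt hy
        (fun z hz hzy => (hlZ z hz hzy).trans_lt hv.1)
        (fun z hz hzy => hv.2.trans_lt ((hcy z hz).2.1 hzy))) hqv
      have hyw : y < w := by
        by_contra hwy
        rcases (not_lt.1 hwy).lt_or_eq with hwy | rfl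
        · have := H.lt_left hy hpos hw (fun _ _ => ⟨Iff.rfl, Iff.rfl⟩) hwy
          linarith
        · linarith
      have := h'.strictMono hyw
      rw [hwv, ← hu, h.lt_iff_lt] at this
      exact absurd hv.2 (not_le.2 this)
    -- Here `l` lies between `u` and `y`, hence in the cell, and monotonicity of `q ∘ h` makes its
    -- value at `u` negative as well.
    · rcases hlu.lt_or_eq with hlu | rfl
      · have := H.lt_right hy hpos hcy (hcy.trans ((hcy.symm).of_mem_uIcc
          (Set.mem_uIcc.2 (Or.inl ⟨hlu.le, hl⟩)))) hlu
        linarith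
      · linarith
  · rw [heq, hroot y heq]
  · rw [sign_pos hgt, eq_comm, sign_eq_one_iff, ← hu]
    by_contra hge
    rw [not_lt] at hge
    obtain ⟨r, hr, hrZ, hr0⟩ := H.exists_ge_pos hy hpos hgt.le
    rcases lt_or_ge u r with hlu | hlu
    · obtain ⟨v, hv, hqv⟩ := intermediate_value_Ico hlu.le hcont.continuousOn
        (⟨hge, hr0⟩ : (0 : ℝ) ∈ Set.Ico _ _)
      obtain ⟨w, hw, hpw, hwv⟩ := H.exists_root_eq hZ hroot hy hpos (SameCell.of_lt_of_lt hy
        (fun z hz hzy => ((hcy z hz).1.1 hzy).trans_le hv.1)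
        (fun z hz hzy => hv.2.trans_le (hrZ z hz hzy))) hqv
      have hyw : w < y := by
        by_contra hwy
        rcases (not_lt.1 hwy).lt_or_eq with hwy | rfl
        · have := H.lt_left hy hpos (fun _ _ => ⟨Iff.rfl, Iff.rfl⟩) hw hwy
          linarith
        · linarith
      have := h'.strictMono hyw
      rw [hwv, ← hu, h.lt_iff_lt] at this
      exact absurd hv.1 (not_le.2 this)
    · rcases hlu.lt_or_eq with hlu | rfl
      · have := H.lt_right hy hpos (hcy.trans ((hcy.symm).of_mem_uIcc
          (Set.mem_uIcc.2 (Or.inr ⟨hr, hlu.le⟩)))) hcy hlu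
        linarith
      · linarith

theorem exists_orderIso (H : SignPair h Z p q) :
    ∃ h' : ℝ ≃o ℝ, (∀ z ∈ Z, h' z = h z) ∧
      ∀ y, SignType.sign (p.eval y) = SignType.sign (q.eval (h' y)) := by
  obtain ⟨f, hf, hfZ, hf0⟩ := H.exists_strictMonoOn
  obtain ⟨h', hh'⟩ := exists_orderIso_of_strictMonoOn _ f hf
  have hp : p ≠ 0 := by
    rintro rfl
    simpa using H.natDegree_left
  have hZ : ∀ z ∈ Z, h' z = h z := fun z hz => by
    rw [hh' z (Finset.mem_union_left _ hz), hfZ z hz]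
  have hroot : ∀ w, p.eval w = 0 → q.eval (h' w) = 0 := fun w hw => by
    rw [hh' w (Finset.mem_union_right _ (by simpa [hp] using hw)), hf0 w hw]
  refine ⟨h', hZ, fun y => ?_⟩
  by_cases hy : y ∈ Z
  · rw [hZ y hy, H.sign_eq y hy]
  rcases lt_or_gt_of_ne fun h => hy (H.mem_of_critical y h) with hlt | hgt
  · have := H.neg.sign_eq_of_derivative_pos hZ (by simpa using hroot) hy (by simpa using hlt)
    simpa [Left.sign_neg] using this
  · exact H.sign_eq_of_derivative_pos hZ hroot hy hgt

end SignPair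

/-- A matching of signs at the roots of the derivative of `p` and of all `q ∈ Q` extends to `p`. -/
theorem exists_orderIso_cons {A : Type*} [CommRing A] {φ ψ : A →+* ℝ} {p : A[X]}
    {Q : Multiset A[X]} {h : ℝ ≃o ℝ} (hφ : 0 < (p.map φ).natDegree)
    (hψ : 0 < (p.map ψ).natDegree)
    (hQ : ∀ q ∈ p.derivative ::ₘ Q, ∀ y, SignType.sign ((q.map φ).eval y) =
      SignType.sign ((q.map ψ).eval (h y)))
    (hp : ∀ q ∈ p.derivative ::ₘ Q, q.map φ ≠ 0 → ∀ z, (q.map φ).eval z = 0 →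
      SignType.sign ((p.map φ).eval z) = SignType.sign ((p.map ψ).eval (h z))) :
    ∃ h' : ℝ ≃o ℝ, ∀ q ∈ p ::ₘ Q, ∀ y, SignType.sign ((q.map φ).eval y) =
      SignType.sign ((q.map ψ).eval (h' y)) := by
  classical
  -- Polynomials that specialize to zero have no finite root set; they are left out here and handled
  -- separately below.
  set Z := (p.derivative ::ₘ Q).toFinset.biUnion fun q => (q.map φ).roots.toFinset with hZ
  have memZ : ∀ z, z ∈ Z ↔ ∃ q ∈ p.derivative ::ₘ Q, q.map φ ≠ 0 ∧ (q.map φ).eval z = 0 := by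
    intro z
    rw [hZ, Finset.mem_biUnion]
    refine exists_congr fun q => ?_
    rw [Multiset.mem_toFinset, Multiset.mem_toFinset, mem_roots', IsRoot.def]
  have H : SignPair h Z (p.map φ) (p.map ψ) := by
    refine ⟨hφ, hψ, fun y => ?_, fun y hy => ?_, fun z hz => ?_⟩
    · rw [derivative_map, derivative_map]
      exact hQ _ (Multiset.mem_cons_self _ _) y
    · refine (memZ y).2 ⟨_, Multiset.mem_cons_self _ _, fun h0 => ?_, by rwa [← derivative_map]⟩
      rw [← derivative_map] at h0
      exact hφ.ne' (derivative_eq_zero.1 h0)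
    · obtain ⟨q, hq, hq0, hz0⟩ := (memZ z).1 hz
      exact hp q hq hq0 z hz0
  obtain ⟨h', hh', hsign⟩ := H.exists_orderIso
  refine ⟨h', fun q hq y => ?_⟩
  rcases Multiset.mem_cons.1 hq with rfl | hq
  · exact hsign y
  replace hq := Multiset.mem_cons_of_mem (b := p.derivative) hq
  have hzero : ∀ t, (q.map ψ).eval (h t) = 0 ↔ (q.map φ).eval t = 0 := fun t => by
    rw [← sign_eq_zero_iff, ← sign_eq_zero_iff (a := eval t _), hQ q hq]
  by_cases h0 : q.map φ = 0
  · have : (q.map ψ).eval (h' y) = 0 := by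
      rw [← h.apply_symm_apply (h' y), hzero, h0, eval_zero]
    rw [this, h0, eval_zero]
  by_cases hy : y ∈ Z
  · rw [hh' y hy, hQ q hq]
  -- Passing from `h` to `h'` only moves points inside a cell of `Z`, where `q ∘ h` has no zero and
  -- so no change of sign.
  · have := sign_eq_of_forall_ne_zero (g := fun t => (q.map ψ).eval (h t))
      ((q.map ψ).continuous.comp h.continuous) (a := y) (b := h.symm (h' y)) fun t ht h1 =>
        ((SignPair.sameCell_symm_apply hh' y).of_mem_uIcc ht).notMem hy
          ((memZ t).2 ⟨q, hq, h0, (hzero t).1 h1⟩)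
    rw [hQ q hq, this, h.apply_symm_apply]

theorem map_eraseLead_of_leadingCoeff_eq_zero {A B : Type*} [CommRing A] [CommRing B]
    (φ : A →+* B) {q : A[X]} (h : φ q.leadingCoeff = 0) : q.eraseLead.map φ = q.map φ := by
  conv_rhs => rw [← q.eraseLead_add_C_mul_X_pow, Polynomial.map_add, Polynomial.map_mul, map_C, h,
    C_0, zero_mul, add_zero]

/-- The order type of the signs of finitely many real polynomials in one variable is determined by
the signs of finitely many polynomial functions of their coefficients. -/
theorem exists_finset_sign_table {A : Type*} [CommRing A] [IsDomain A] [CharZero A]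
    (L : Multiset A[X]) : ∃ T : Finset A, ∀ φ ψ : A →+* ℝ,
      (∀ t ∈ T, SignType.sign (φ t) = SignType.sign (ψ t)) →
      ∃ h : ℝ ≃o ℝ, ∀ q ∈ L, ∀ y, SignType.sign ((q.map φ).eval y) =
        SignType.sign ((q.map ψ).eval (h y)) := by
  classical
  induction L using multiset_polynomial_induction with
  | step L ih =>
  by_cases hconst : ∀ q ∈ L, q.natDegree = 0
  · refine ⟨L.toFinset.image fun q => q.coeff 0, fun φ ψ hT => ⟨OrderIso.refl ℝ, fun q hq y => ?_⟩⟩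
    rw [eq_C_of_natDegree_eq_zero (hconst q hq)]
    simpa using hT (q.coeff 0)
      (Finset.mem_image_of_mem (fun q => q.coeff 0) (Multiset.mem_toFinset.2 hq))
  push Not at hconst
  -- Prepares the case in which the specialization kills the leading coefficient of `q`: erasing the
  -- leading term then changes nothing but lowers the degree.
  have vanish : ∀ q, ∃ T : Finset A, q ∈ L → q ≠ 0 → ∀ φ ψ : A →+* ℝ,
      (∀ t ∈ T, SignType.sign (φ t) = SignType.sign (ψ t)) →
      ∃ h : ℝ ≃o ℝ, ∀ r ∈ {q.eraseLead} + L.erase q, ∀ y,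
        SignType.sign ((r.map φ).eval y) = SignType.sign ((r.map ψ).eval (h y)) := by
    intro q
    by_cases hq : q ∈ L ∧ q ≠ 0
    · obtain ⟨T, hT⟩ := ih q (L.erase q) {q.eraseLead} (Multiset.cons_erase hq.1).symm (by
        simpa using degree_eraseLead_lt hq.2)
      exact ⟨T, fun _ _ => hT⟩
    · exact ⟨∅, fun h1 h2 => absurd ⟨h1, h2⟩ hq⟩
  choose T₁ hT₁ using vanish
  obtain ⟨q₀, hq₀, hq₀'⟩ := hconst
  -- Maximality of the degree of `p` makes its remainder modulo every other member of the family
  -- smaller than `p` itself.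
  obtain ⟨p, hpL, hmax⟩ := L.toFinset.exists_max_image degree ⟨q₀, Multiset.mem_toFinset.2 hq₀⟩
  rw [Multiset.mem_toFinset] at hpL
  have hp : 0 < p.natDegree := (Nat.pos_of_ne_zero hq₀').trans_le
    (natDegree_le_natDegree (hmax q₀ (Multiset.mem_toFinset.2 hq₀)))
  have hp0 : p ≠ 0 := by
    rintro rfl
    simp at hp
  choose k s r hdiv hr using exists_pseudo_division p
  have hder : p.derivative.degree < p.degree := degree_derivative_lt hp0
  -- In the new family `p` gives way to its derivative and to its remainders modulo the derivative
  -- and modulo each other polynomial.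
  obtain ⟨T₂, hT₂⟩ := ih p (L.erase p)
    (p.derivative ::ₘ (p.derivative ::ₘ L.erase p).map r) (Multiset.cons_erase hpL).symm (by
      intro g hg
      rcases Multiset.mem_cons.1 hg with rfl | hg
      · exact hder
      obtain ⟨q, hq, rfl⟩ := Multiset.mem_map.1 hg
      rcases hr q with h0 | hlt
      · rw [h0, degree_zero, bot_lt_iff_ne_bot]
        exact degree_ne_bot.2 hp0
      · refine hlt.trans_le ?_
        rcases Multiset.mem_cons.1 hq with rfl | hq
        · exact hder.le
        · exact hmax q (Multiset.mem_toFinset.2 (Multiset.mem_of_mem_erase hq)))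
  refine ⟨T₂ ∪ L.toFinset.biUnion T₁ ∪ (p.derivative ::ₘ L).toFinset.image leadingCoeff,
    fun φ ψ hT => ?_⟩
  have hlc : ∀ q ∈ p.derivative ::ₘ L, SignType.sign (φ q.leadingCoeff) =
      SignType.sign (ψ q.leadingCoeff) := fun q hq => hT _ (Finset.mem_union_right _
    (Finset.mem_image_of_mem _ (Multiset.mem_toFinset.2 hq)))
  by_cases hv : ∃ q ∈ L, q ≠ 0 ∧ φ q.leadingCoeff = 0
  · obtain ⟨q, hq, hq0, hφq⟩ := hv
    have hψq : ψ q.leadingCoeff = 0 := by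
      rw [← sign_eq_zero_iff, ← hlc q (Multiset.mem_cons_of_mem hq), hφq, sign_zero]
    obtain ⟨h, hh⟩ := hT₁ q hq hq0 φ ψ fun t ht => hT t (Finset.mem_union_left _
      (Finset.mem_union_right _ (Finset.mem_biUnion.2 ⟨q, Multiset.mem_toFinset.2 hq, ht⟩)))
    refine ⟨h, fun g hg y => ?_⟩
    rw [← Multiset.cons_erase hq] at hg
    rcases Multiset.mem_cons.1 hg with rfl | hg
    · have := hh g.eraseLead (by simp) y
      rwa [map_eraseLead_of_leadingCoeff_eq_zero φ hφq,
        map_eraseLead_of_leadingCoeff_eq_zero ψ hψq] at this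
    · exact hh g (Multiset.mem_add.2 (Or.inr hg)) y
  push Not at hv
  have hφp := hv p hpL hp0
  have hψp : ψ p.leadingCoeff ≠ 0 := by
    rwa [← sign_ne_zero, ← hlc p (Multiset.mem_cons_of_mem hpL), sign_ne_zero]
  obtain ⟨h, hh⟩ := hT₂ φ ψ fun t ht => hT t (Finset.mem_union_left _
      (Finset.mem_union_left _ ht))
  have hQ : ∀ q ∈ p.derivative ::ₘ L.erase p, ∀ y, SignType.sign ((q.map φ).eval y) =
      SignType.sign ((q.map ψ).eval (h y)) := by
    intro q hq
    refine hh q ?_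
    simp only [Multiset.mem_cons, Multiset.mem_add] at hq ⊢
    tauto
  rw [← Multiset.cons_erase hpL]
  refine exists_orderIso_cons (h := h) (by rwa [natDegree_map_of_leadingCoeff_ne_zero _ hφp])
    (by rwa [natDegree_map_of_leadingCoeff_ne_zero _ hψp]) hQ ?_
  intro q hq hqφ z hz
  have hq0 : q ≠ 0 := by
    rintro rfl
    simp at hqφ
  have hq1 : φ q.leadingCoeff ≠ 0 := by
    rcases Multiset.mem_cons.1 hq with rfl | hq
    · rw [leadingCoeff_derivative, map_mul, map_natCast]
      exact mul_ne_zero hφp (Nat.cast_ne_zero.2 hp.ne')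
    · exact hv q (Multiset.mem_of_mem_erase hq) hq0
  have hz' : (q.map ψ).eval (h z) = 0 := by
    rw [← sign_eq_zero_iff, ← hQ q hq, hz, sign_zero]
  -- At a root of `q` the pseudo-division loses its quotient term, so the sign of `p` follows from
  -- those of the remainder and the leading coefficient.
  have eqn : ∀ (χ : A →+* ℝ) (x : ℝ), (q.map χ).eval x = 0 →
      χ q.leadingCoeff ^ k q * (p.map χ).eval x = ((r q).map χ).eval x := by
    intro χ x hx
    have := congrArg (fun f => (f.map χ).eval x) (hdiv q)
    simpa [hx] using this
  have e1 := congrArg SignType.sign (eqn φ z hz)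
  have e2 := congrArg SignType.sign (eqn ψ (h z) hz')
  rw [← hh (r q) (by
    exact Multiset.mem_add.2 (Or.inl (Multiset.mem_cons_of_mem (Multiset.mem_map_of_mem r hq)))),
    ← e1, sign_mul, sign_mul, sign_pow, sign_pow, ← hlc q (by
      rcases Multiset.mem_cons.1 hq with rfl | hq
      · exact Multiset.mem_cons_self _ _
      · exact Multiset.mem_cons_of_mem (Multiset.mem_of_mem_erase hq))] at e2
  exact (mul_left_cancel₀ (pow_ne_zero _ (sign_ne_zero.2 hq1)) e2).symm

/-! ### Polynomials over an algebraically closed field -/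

/-- Each of the `f.natDegree` linear factors of `f`, counted with multiplicity, divides one factor
`g` of the power. -/
theorem dvd_pow_natDegree_of_roots {K : Type*} [Field K] [IsAlgClosed K] {f g : K[X]}
    (hf : f ≠ 0) (h : ∀ y, f.eval y = 0 → g.eval y = 0) : f ∣ g ^ f.natDegree := by
  have key : ∀ s : Multiset K, (∀ y ∈ s, g.eval y = 0) →
      (s.map fun y => X - C y).prod ∣ g ^ s.card := by
    intro s
    induction s using Multiset.induction_on with
    | empty => simp
    | cons a s ih =>
      intro hs
      rw [Multiset.map_cons, Multiset.prod_cons, Multiset.card_cons, pow_succ']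
      exact mul_dvd_mul (dvd_iff_isRoot.2 (hs a (Multiset.mem_cons_self a s)))
        (ih fun y hy => hs y (Multiset.mem_cons_of_mem hy))
  have hs := IsAlgClosed.splits f
  have hk := key f.roots fun y hy => h y (isRoot_of_mem_roots hy)
  rw [← hs.natDegree_eq_card_roots] at hk
  rw [hs.eq_prod_roots]
  conv_rhs => rw [← hs.eq_prod_roots]
  exact (C_mul_dvd (leadingCoeff_ne_zero.2 hf)).2 hk

theorem dvd_pow_natDegree_iff {K : Type*} [Field K] [IsAlgClosed K] {f g : K[X]} (hf : f ≠ 0) :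
    f ∣ g ^ f.natDegree ↔ ¬ ∃ y, f.eval y = 0 ∧ g.eval y ≠ 0 := by
  refine ⟨?_, fun h => dvd_pow_natDegree_of_roots hf fun y hy => ?_⟩
  · rintro h ⟨y, hy, hg⟩
    have := eval_dvd (x := y) h
    rw [hy, zero_dvd_iff, eval_pow] at this
    exact hg (eq_zero_of_pow_eq_zero this)
  · by_contra hg
    exact h ⟨y, hy, hg⟩

theorem map_eq_zero_iff_coeff {A B : Type*} [CommRing A] [CommRing B] (φ : A →+* B) (r : A[X]) :
    r.map φ = 0 ↔ ∀ t ∈ r.coeffs, φ t = 0 := by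
  constructor
  · intro h t ht
    obtain ⟨n, -, rfl⟩ := mem_coeffs_iff.1 ht
    rw [← coeff_map, h, coeff_zero]
  · intro h
    ext n
    rw [coeff_map, coeff_zero]
    by_cases h0 : r.coeff n = 0
    · rw [h0, map_zero]
    · exact h _ (coeff_mem_coeffs h0)

/-- The specialized leading coefficient is a unit, so divisibility is that of the remainder, whose
degree is too small unless it vanishes. Hence divisibility becomes a condition on finitely many
coefficients. -/
theorem map_dvd_map_pow_iff {A K : Type*} [CommRing A] [Field K] (φ : A →+* K)
    {f g s r : A[X]} {k : ℕ} (hf : φ f.leadingCoeff ≠ 0)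
    (h : C (f.leadingCoeff ^ k) * g = s * f + r) (hr : r = 0 ∨ r.degree < f.degree) :
    f.map φ ∣ g.map φ ↔ r.map φ = 0 := by
  have h' := congrArg (Polynomial.map φ) h
  rw [Polynomial.map_mul, map_C, map_pow, Polynomial.map_add, Polynomial.map_mul] at h'
  rw [← dvd_C_mul (pow_ne_zero k hf), h', dvd_add_right (dvd_mul_left _ _)]
  refine ⟨fun hd => ?_, fun h0 => h0 ▸ dvd_zero _⟩
  rcases hr with rfl | hr
  · simp
  · refine eq_zero_of_dvd_of_degree_lt hd ?_
    rw [degree_map_eq_of_leadingCoeff_ne_zero φ hf]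
    exact (degree_map_le).trans_lt hr

/-- Whether finitely many polynomials in one variable over an algebraically closed field have a
common zero that is not a zero of `g` is determined by the vanishing of finitely many polynomial
functions of the coefficients. -/
theorem exists_finset_zero_pattern {A : Type*} [CommRing A] [IsDomain A] (K : Type*) [Field K]
    [IsAlgClosed K] (g : A[X]) (L : Multiset A[X]) : ∃ T : Finset A, ∀ φ ψ : A →+* K,
      (∀ t ∈ T, φ t = 0 ↔ ψ t = 0) →
      (∃ y, (∀ f ∈ L, (f.map φ).eval y = 0) ∧ (g.map φ).eval y ≠ 0) →
      ∃ y, (∀ f ∈ L, (f.map ψ).eval y = 0) ∧ (g.map ψ).eval y ≠ 0 := by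
  classical
  induction L using multiset_polynomial_induction with
  | step L ih =>
  by_cases hzero : ∀ f ∈ L, f = 0
  · refine ⟨g.coeffs, fun φ ψ hT hφ => ?_⟩
    obtain ⟨y, -, hy⟩ := hφ
    have hg : g.map ψ ≠ 0 := by
      intro h0
      rw [map_eq_zero_iff_coeff] at h0
      have : g.map φ = 0 := (map_eq_zero_iff_coeff φ g).2 fun t ht => (hT t ht).2 (h0 t ht)
      rw [this, eval_zero] at hy
      exact hy rfl
    -- Without equations it is enough that `g` specializes to a nonzero polynomial, because the
    -- field is infinite.
    obtain ⟨z, hz⟩ := exists_eval_ne_zero_of_natDegree_lt_card (g.map ψ) hg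
      ((Cardinal.natCast_lt_aleph0).trans_le (Cardinal.aleph0_le_mk K))
    exact ⟨z, fun f hf => by rw [hzero f hf, Polynomial.map_zero, eval_zero], hz⟩
  push Not at hzero
  have vanish : ∀ q, ∃ T : Finset A, q ∈ L → q ≠ 0 → ∀ φ ψ : A →+* K,
      (∀ t ∈ T, φ t = 0 ↔ ψ t = 0) →
      (∃ y, (∀ f ∈ {q.eraseLead} + L.erase q, (f.map φ).eval y = 0) ∧ (g.map φ).eval y ≠ 0) →
      ∃ y, (∀ f ∈ {q.eraseLead} + L.erase q, (f.map ψ).eval y = 0) ∧ (g.map ψ).eval y ≠ 0 := by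
    intro q
    by_cases hq : q ∈ L ∧ q ≠ 0
    · obtain ⟨T, hT⟩ := ih q (L.erase q) {q.eraseLead} (Multiset.cons_erase hq.1).symm (by
        simpa using degree_eraseLead_lt hq.2)
      exact ⟨T, fun _ _ => hT⟩
    · exact ⟨∅, fun h1 h2 => absurd ⟨h1, h2⟩ hq⟩
  choose T₁ hT₁ using vanish
  -- Reduces to specializations under which no leading coefficient of a nonzero member of `L`
  -- vanishes.
  have reduce : ∀ T₂ : Finset A, (∀ φ ψ : A →+* K,
      (∀ q ∈ L, q ≠ 0 → φ q.leadingCoeff ≠ 0) → (∀ q ∈ L, q ≠ 0 → ψ q.leadingCoeff ≠ 0) →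
      (∀ t ∈ T₂, φ t = 0 ↔ ψ t = 0) →
      (∃ y, (∀ f ∈ L, (f.map φ).eval y = 0) ∧ (g.map φ).eval y ≠ 0) →
      ∃ y, (∀ f ∈ L, (f.map ψ).eval y = 0) ∧ (g.map ψ).eval y ≠ 0) →
      ∃ T : Finset A, ∀ φ ψ : A →+* K, (∀ t ∈ T, φ t = 0 ↔ ψ t = 0) →
      (∃ y, (∀ f ∈ L, (f.map φ).eval y = 0) ∧ (g.map φ).eval y ≠ 0) →
      ∃ y, (∀ f ∈ L, (f.map ψ).eval y = 0) ∧ (g.map ψ).eval y ≠ 0 := by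
    intro T₂ hT₂
    refine ⟨T₂ ∪ L.toFinset.biUnion T₁ ∪ L.toFinset.image leadingCoeff, fun φ ψ hT hy => ?_⟩
    have hlc : ∀ q ∈ L, (φ q.leadingCoeff = 0 ↔ ψ q.leadingCoeff = 0) := fun q hq =>
      hT _ (Finset.mem_union_right _ (Finset.mem_image_of_mem _ (Multiset.mem_toFinset.2 hq)))
    by_cases hv : ∃ q ∈ L, q ≠ 0 ∧ φ q.leadingCoeff = 0
    · obtain ⟨q, hq, hq0, hφq⟩ := hv
      have hmem : ∀ (χ : A →+* K) (y : K), χ q.leadingCoeff = 0 →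
          ((∀ f ∈ {q.eraseLead} + L.erase q, (f.map χ).eval y = 0) ↔
            ∀ f ∈ L, (f.map χ).eval y = 0) := by
        intro χ y hχ
        conv_rhs => rw [← Multiset.cons_erase hq]
        rw [Multiset.singleton_add, Multiset.forall_mem_cons, Multiset.forall_mem_cons,
          map_eraseLead_of_leadingCoeff_eq_zero χ hχ]
      have := hT₁ q hq hq0 φ ψ fun t ht => hT t (Finset.mem_union_left _
        (Finset.mem_union_right _ (Finset.mem_biUnion.2 ⟨q, Multiset.mem_toFinset.2 hq, ht⟩)))
      simp only [hmem φ _ hφq, hmem ψ _ ((hlc q hq).1 hφq)] at this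
      exact this hy
    · push Not at hv
      exact hT₂ φ ψ hv (fun q hq hq0 => (not_congr (hlc q hq)).1 (hv q hq hq0))
        (fun t ht => hT t (Finset.mem_union_left _ (Finset.mem_union_left _ ht))) hy
  obtain ⟨p₀, hp₀, hp₀'⟩ := hzero
  obtain ⟨p, hpL, hmax⟩ := L.toFinset.exists_max_image degree ⟨p₀, Multiset.mem_toFinset.2 hp₀⟩
  rw [Multiset.mem_toFinset] at hpL
  have hp0 : p ≠ 0 := by
    rintro rfl
    have := hmax p₀ (Multiset.mem_toFinset.2 hp₀)
    rw [degree_zero, le_bot_iff, degree_eq_bot] at this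
    exact hp₀' this
  by_cases hsingle : ∀ q ∈ L.erase p, q = 0
  -- With one equation left, solvability means that `p` does not divide `g ^ deg p`, that is, some
  -- coefficient of this remainder survives.
  · obtain ⟨k, s, r, hdiv, hr⟩ := exists_pseudo_division (g ^ p.natDegree) p
    refine reduce r.coeffs fun φ ψ hφ hψ hT => ?_
    have key : ∀ χ : A →+* K, χ p.leadingCoeff ≠ 0 →
        ((∃ y, (∀ f ∈ L, (f.map χ).eval y = 0) ∧ (g.map χ).eval y ≠ 0) ↔
          ¬ ∀ t ∈ r.coeffs, χ t = 0) := by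
      intro χ hχ
      have hne : p.map χ ≠ 0 := fun h0 => hχ (by
        rw [leadingCoeff, ← coeff_map, h0, coeff_zero])
      rw [← map_eq_zero_iff_coeff, ← map_dvd_map_pow_iff χ hχ hdiv hr, Polynomial.map_pow,
        ← natDegree_map_of_leadingCoeff_ne_zero χ hχ, dvd_pow_natDegree_iff hne, not_not]
      refine exists_congr fun y => and_congr_left fun _ => ?_
      rw [← Multiset.cons_erase hpL, Multiset.forall_mem_cons]
      refine and_iff_left fun f hf => ?_
      rw [hsingle f hf, Polynomial.map_zero, eval_zero]
    rw [key φ (hφ p hpL hp0), key ψ (hψ p hpL hp0)]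
    exact mt fun h t ht => (hT t ht).2 (h t ht)
  · push Not at hsingle
    obtain ⟨q, hq, hq0⟩ := hsingle
    have hqL := Multiset.mem_of_mem_erase hq
    -- At a zero of `q` the values of `p` and `r` differ by a nonzero factor, so `r` may replace `p`
    -- without changing the common zeros.
    obtain ⟨k, s, r, hdiv, hr⟩ := exists_pseudo_division p q
    obtain ⟨T₂, hT₂⟩ := ih p (L.erase p) {r} (Multiset.cons_erase hpL).symm (by
      intro r' hr'
      obtain rfl := Multiset.mem_singleton.1 hr'
      rcases hr with rfl | hlt
      · rw [degree_zero, bot_lt_iff_ne_bot]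
        exact degree_ne_bot.2 hp0
      · exact hlt.trans_le (hmax q (Multiset.mem_toFinset.2 hqL)))
    refine reduce T₂ fun φ ψ hφ hψ hT => ?_
    have hmem : ∀ (χ : A →+* K) (y : K), χ q.leadingCoeff ≠ 0 →
        ((∀ f ∈ {r} + L.erase p, (f.map χ).eval y = 0) ↔ ∀ f ∈ L, (f.map χ).eval y = 0) := by
      intro χ y hχ
      conv_rhs => rw [← Multiset.cons_erase hpL]
      rw [Multiset.singleton_add, Multiset.forall_mem_cons, Multiset.forall_mem_cons]
      refine and_congr_left fun hL => ?_
      have := congrArg (fun f => (f.map χ).eval y) hdiv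
      simp only [Polynomial.map_mul, map_C, RingHom.map_pow χ, eval_mul, eval_C,
        Polynomial.map_add, eval_add, hL q hq, mul_zero, zero_add] at this
      rw [← this, mul_eq_zero, or_iff_right (pow_ne_zero k hχ)]
    have := hT₂ φ ψ hT
    simpa only [hmem φ _ (hφ q hqL hq0), hmem ψ _ (hψ q hqL hq0)] using this

end MatrixQE

namespace MatrixQE

open FirstOrder FirstOrder.Language FirstOrder.Ring

/-! ### Sets defined by quantifier-free formulas -/

section QFDefinable

variable (L : FirstOrder.Language.{u, v}) {M : Type w} [L.Structure M] {α β : Type}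

/-- The sets defined by a quantifier-free formula without parameters. -/
def QFDefinable (s : Set (α → M)) : Prop :=
  ∃ ψ : L.Formula α, ψ.IsQF ∧ ∀ x, x ∈ s ↔ ψ.Realize x

variable {L} {s t : Set (α → M)}

theorem QFDefinable.compl (hs : QFDefinable L s) : QFDefinable L sᶜ := by
  obtain ⟨ψ, hψ, h⟩ := hs
  exact ⟨ψ.not, hψ.not, fun x => by rw [Set.mem_compl_iff, h, Formula.realize_not]⟩

theorem QFDefinable.inter (hs : QFDefinable L s) (ht : QFDefinable L t) :
    QFDefinable L (s ∩ t) := by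
  obtain ⟨ψ, hψ, h⟩ := hs
  obtain ⟨ψ', hψ', h'⟩ := ht
  exact ⟨ψ ⊓ ψ', hψ.inf hψ', fun x => by rw [Set.mem_inter_iff, h, h', Formula.realize_inf]⟩

theorem QFDefinable.union (hs : QFDefinable L s) (ht : QFDefinable L t) :
    QFDefinable L (s ∪ t) := by
  rw [← compl_compl (s ∪ t), Set.compl_union]
  exact (hs.compl.inter ht.compl).compl

theorem QFDefinable.empty : QFDefinable L (∅ : Set (α → M)) :=
  ⟨⊥, BoundedFormula.isQF_bot, fun x => by simp⟩

theorem QFDefinable.univ : QFDefinable L (Set.univ : Set (α → M)) := by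
  rw [← Set.compl_empty]
  exact QFDefinable.empty.compl

theorem QFDefinable.term_eq (t₁ t₂ : L.Term α) :
    QFDefinable L {x : α → M | t₁.realize x = t₂.realize x} :=
  ⟨t₁.equal t₂, (BoundedFormula.IsAtomic.equal _ _).isQF, fun x => by
    rw [Formula.realize_equal, Set.mem_ofPred_eq]⟩

theorem QFDefinable.rel {n : ℕ} (R : L.Relations n) (ts : Fin n → L.Term α) :
    QFDefinable L {x : α → M | Structure.RelMap R fun i => (ts i).realize x} :=
  ⟨R.formula ts, (BoundedFormula.IsAtomic.rel _ _).isQF, fun x => by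
    rw [Formula.realize_rel, Set.mem_ofPred_eq]⟩

/-- A set that is determined by finitely many quantifier-free definable sets. -/
theorem QFDefinable.of_finset {ι : Type*} (T : Finset ι) (S : ι → Set (α → M))
    (hS : ∀ i, QFDefinable L (S i)) (U : Set (α → M))
    (hU : ∀ x y, (∀ i ∈ T, x ∈ S i ↔ y ∈ S i) → x ∈ U → y ∈ U) : QFDefinable L U := by
  classical
  induction T using Finset.induction_on generalizing U with
  | empty =>
    rcases U.eq_empty_or_nonempty with rfl | ⟨x, hx⟩
    · exact QFDefinable.empty
    · rw [Set.eq_univ_of_forall fun y => hU x y (by simp) hx]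
      exact QFDefinable.univ
  | insert i T hi ih =>
    have key : ∀ V : Set (α → M), (∀ x y, x ∈ V → y ∈ V → (x ∈ S i ↔ y ∈ S i)) →
        (QFDefinable L V) → QFDefinable L (U ∩ V) := by
      intro V hV hVdef
      -- This is the saturation of `U ∩ V` under agreement on `T`; since `V` decides membership in
      -- `S i`, intersecting with `V` gives back `U ∩ V`.
      have := ih {x | ∃ y ∈ U ∩ V, ∀ j ∈ T, y ∈ S j ↔ x ∈ S j} (by
        rintro x y hxy ⟨z, hz, hzx⟩
        exact ⟨z, hz, fun j hj => (hzx j hj).trans (hxy j hj)⟩)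
      convert this.inter hVdef using 1
      ext x
      constructor
      · rintro ⟨hx, hxV⟩
        exact ⟨⟨x, ⟨hx, hxV⟩, fun _ _ => Iff.rfl⟩, hxV⟩
      · rintro ⟨⟨y, ⟨hy, hyV⟩, hyx⟩, hxV⟩
        refine ⟨hU y x (fun j hj => ?_) hy, hxV⟩
        rcases Finset.mem_insert.1 hj with rfl | hj
        · exact hV y x hyV hxV
        · exact hyx j hj
    rw [← Set.inter_univ U, ← Set.union_compl_self (S i), Set.inter_union_distrib_left]
    exact (key _ (fun x y hx hy => by simp [hx, hy]) (hS i)).union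
      (key _ (fun x y hx hy => by simp_all) (hS i).compl)

variable (L M) in
/-- Quantifier elimination follows from the elimination of one existential quantifier. -/
theorem hasQE_of_exists
    (h : ∀ (k : ℕ) (s : Set (Fin (k + 1) → M)), QFDefinable L s →
      QFDefinable L {x : Fin k → M | ∃ a, (Fin.snoc x a : Fin (k + 1) → M) ∈ s}) :
    HasQE (inferInstance : L.Structure M) := by
  -- Free and bound variables are merged into one tuple, with the innermost bound variable last, to
  -- fit the shape of `h`.
  have key : ∀ (k n : ℕ) (φ : L.BoundedFormula (Fin k) n), QFDefinable L
      {x : Fin (k + n) → M | φ.Realize (x ∘ Fin.castAdd n) (x ∘ Fin.natAdd k)} := by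
    intro k n φ
    have hterm : ∀ {n : ℕ} (t : L.Term (Fin k ⊕ Fin n)) (x : Fin (k + n) → M),
        t.realize (Sum.elim (x ∘ Fin.castAdd n) (x ∘ Fin.natAdd k)) =
          (t.relabel (Sum.elim (Fin.castAdd n) (Fin.natAdd k))).realize x := by
      intro n t x
      rw [Term.realize_relabel, Sum.comp_elim]
    induction φ with
    | falsum => exact QFDefinable.empty
    | equal t₁ t₂ =>
      simp only [BoundedFormula.Realize, hterm]
      exact QFDefinable.term_eq _ _
    | rel R ts =>
      simp only [BoundedFormula.Realize, hterm]
      exact QFDefinable.rel R _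
    | imp φ₁ φ₂ ih₁ ih₂ =>
      convert ih₁.compl.union ih₂ using 1
      ext x
      simp [imp_iff_not_or]
    | @all n φ ih =>
      convert (h (k + n) _ ih.compl).compl using 1
      ext x
      simp only [Set.mem_ofPred_eq, BoundedFormula.realize_all, Set.mem_compl_iff, not_exists,
        not_not]
      refine forall_congr' fun a => ?_
      have e1 : (Fin.snoc x a : Fin (k + n + 1) → M) ∘ Fin.castAdd (n + 1) =
          x ∘ Fin.castAdd n := by
        funext i
        exact Fin.snoc_castSucc (α := fun _ => M) a x (Fin.castAdd n i)
      have e2 : (Fin.snoc x a : Fin (k + n + 1) → M) ∘ Fin.natAdd k =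
          Fin.snoc (x ∘ Fin.natAdd k) a := by
        funext i
        refine Fin.lastCases ?_ (fun j => ?_) i
        · rw [Fin.snoc_last]
          exact Fin.snoc_last (α := fun _ => M) a x
        · rw [Fin.snoc_castSucc]
          exact Fin.snoc_castSucc (α := fun _ => M) a x (Fin.natAdd k j)
      exact iff_of_eq (congrArg₂ _ e1.symm e2.symm)
  intro k φ
  obtain ⟨ψ, hψ, h⟩ := key k 0 φ
  refine ⟨ψ, hψ, fun x => ?_⟩
  rw [← h x, Set.mem_ofPred_eq, Formula.Realize]
  exact iff_of_eq (congrArg₂ _ rfl (Subsingleton.elim _ _))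

end QFDefinable

/-! ### Relational expansions of commutative rings -/

/-- Reads an integer polynomial as one in its last variable, with the parameters confined to the
coefficients that get specialized. -/
theorem eval_map_aeval_snoc {K : Type*} [CommRing K] {k : ℕ} (x : Fin k → K) (a : K) (P : MvPolynomial (Fin (k + 1)) ℤ) :
    (((MvPolynomial.aeval (Fin.snoc (fun i => Polynomial.C (MvPolynomial.X i)) Polynomial.X :
      Fin (k + 1) → Polynomial (MvPolynomial (Fin k) ℤ))) P).map
        (MvPolynomial.aeval x : MvPolynomial (Fin k) ℤ →ₐ[ℤ] K).toRingHom).eval a =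
      MvPolynomial.aeval (Fin.snoc x a : Fin (k + 1) → K) P := by
  induction P using MvPolynomial.induction_on with
  | C z => simp
  | add P Q hP hQ => simp only [map_add, Polynomial.map_add, Polynomial.eval_add, hP, hQ]
  | mul_X P i hP =>
    rw [map_mul, map_mul, Polynomial.map_mul, Polynomial.eval_mul, hP, MvPolynomial.aeval_X,
      MvPolynomial.aeval_X]
    congr 1
    refine Fin.lastCases ?_ (fun j => ?_) i
    · simp
    · simp

section RelationalExpansion

variable {L : FirstOrder.Language.{u, v}} {K : Type w} [CommRing K] [CompatibleRing K] [L.Structure K]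

theorem exists_mvPolynomial_realize_eq [L.IsRelational] {β : Type}
    (t : (Language.ring.sum L).Term (β ⊕ Fin 0)) :
    ∃ P : MvPolynomial β ℤ, ∀ (x : β → K) (xs : Fin 0 → K),
      t.realize (Sum.elim x xs) = MvPolynomial.aeval x P := by
  induction t with
  | var i =>
    rcases i with i | i
    · exact ⟨MvPolynomial.X i, fun x xs => by simp⟩
    · exact i.elim0
  | func f ts ih =>
    choose P hP using ih
    rcases f with f | f
    · cases f with
      | add => exact ⟨P 0 + P 1, fun x xs => (CompatibleRing.funMap_add _).trans (by
          rw [map_add, hP, hP])⟩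
      | mul => exact ⟨P 0 * P 1, fun x xs => (CompatibleRing.funMap_mul _).trans (by
          rw [map_mul, hP, hP])⟩
      | neg => exact ⟨-P 0, fun x xs => (CompatibleRing.funMap_neg _).trans (by
          rw [map_neg, hP])⟩
      | zero => exact ⟨0, fun x xs => (CompatibleRing.funMap_zero _).trans (map_zero _).symm⟩
      | one => exact ⟨1, fun x xs => (CompatibleRing.funMap_one _).trans (map_one _).symm⟩
    · exact isEmptyElim f

variable (L K) in
theorem exists_term_realize_eq {β : Type} (P : MvPolynomial β ℤ) :
    ∃ t : (Language.ring.sum L).Term β, ∀ x : β → K, t.realize x = MvPolynomial.aeval x P := by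
  refine ⟨LHom.sumInl.onTerm (termOfFreeCommRing ((freeCommRingEquivMvPolynomialInt β).symm P)),
    fun x => ?_⟩
  rw [LHom.realize_onTerm, realize_termOfFreeCommRing]
  obtain ⟨Q, rfl⟩ := (freeCommRingEquivMvPolynomialInt β).surjective P
  rw [RingEquiv.symm_apply_apply]
  have : (FreeCommRing.lift x : FreeCommRing β →+* K) =
      (MvPolynomial.aeval x : MvPolynomial β ℤ →ₐ[ℤ] K).toRingHom.comp
        (freeCommRingEquivMvPolynomialInt β).toRingHom := by
    refine FreeCommRing.hom_ext fun b => ?_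
    simp [freeCommRingEquivMvPolynomialInt]
  exact RingHom.congr_fun this Q

variable {σ : Type} (c : K → σ)

/-- An equation of terms is the vanishing of a difference of polynomials, and a relation between
terms is handled by substitution into the polynomials from `hrel`. -/
theorem IsQF.exists_finset_mvPolynomial [L.IsRelational] (hc : ∀ a b, c a = c b → (a = 0 ↔ b = 0))
    (hrel : ∀ {m : ℕ} (R : L.Relations m), ∃ T : Finset (MvPolynomial (Fin m) ℤ),
      ∀ x y : Fin m → K, (∀ P ∈ T, c (MvPolynomial.aeval x P) = c (MvPolynomial.aeval y P)) →
        (Structure.RelMap R x ↔ Structure.RelMap R y))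
    {β : Type} {φ : (Language.ring.sum L).BoundedFormula β 0} (hφ : φ.IsQF) :
    ∃ T : Finset (MvPolynomial β ℤ), ∀ (x y : β → K) (xs : Fin 0 → K),
      (∀ P ∈ T, c (MvPolynomial.aeval x P) = c (MvPolynomial.aeval y P)) →
        (φ.Realize x xs ↔ φ.Realize y xs) := by
  classical
  induction hφ with
  | falsum => exact ⟨∅, fun _ _ _ _ => Iff.rfl⟩
  | of_isAtomic h =>
    induction h with
    | equal t₁ t₂ =>
      obtain ⟨P₁, h₁⟩ := exists_mvPolynomial_realize_eq (K := K) t₁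
      obtain ⟨P₂, h₂⟩ := exists_mvPolynomial_realize_eq (K := K) t₂
      refine ⟨{P₁ - P₂}, fun x y xs h => ?_⟩
      rw [BoundedFormula.realize_bdEqual, BoundedFormula.realize_bdEqual, h₁, h₂, h₁, h₂,
        ← sub_eq_zero, ← sub_eq_zero (a := MvPolynomial.aeval y P₁), ← map_sub, ← map_sub]
      exact hc _ _ (h _ (Finset.mem_singleton_self _))
    | @rel m R ts =>
      rcases R with R | R
      · exact isEmptyElim R
      choose P hP using fun i => exists_mvPolynomial_realize_eq (K := K) (ts i)
      obtain ⟨T, hT⟩ := hrel R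
      refine ⟨T.image (MvPolynomial.aeval P), fun x y xs h => ?_⟩
      change (Structure.RelMap R fun i => (ts i).realize (Sum.elim x xs)) ↔
        Structure.RelMap R fun i => (ts i).realize (Sum.elim y xs)
      simp only [hP]
      refine hT _ _ fun Q hQ => ?_
      have := h _ (Finset.mem_image_of_mem _ hQ)
      have hcomp : ∀ x : β → K, MvPolynomial.aeval x (MvPolynomial.aeval P Q) =
          MvPolynomial.aeval (fun i => MvPolynomial.aeval x (P i)) Q := fun x =>
        MvPolynomial.comp_aeval_apply P (MvPolynomial.aeval x) Q
      rwa [hcomp, hcomp] at this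
  | imp _ _ ih₁ ih₂ =>
    obtain ⟨T₁, h₁⟩ := ih₁
    obtain ⟨T₂, h₂⟩ := ih₂
    refine ⟨T₁ ∪ T₂, fun x y xs h => ?_⟩
    rw [BoundedFormula.realize_imp, BoundedFormula.realize_imp,
      h₁ x y xs fun P hP => h P (Finset.mem_union_left _ hP),
      h₂ x y xs fun P hP => h P (Finset.mem_union_right _ hP)]

/-- A criterion for quantifier elimination. The quantifier-free type of a tuple is given by the
values of `c` at the integer polynomials in the tuple, and for finitely many polynomials in one
variable the possible patterns of these values depend on finitely many values of `c` at the
coefficients. -/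
theorem hasQE_of_patterns [L.IsRelational] [Finite σ] (hc : ∀ a b, c a = c b → (a = 0 ↔ b = 0))
    (hrel : ∀ {m : ℕ} (R : L.Relations m), ∃ T : Finset (MvPolynomial (Fin m) ℤ),
      ∀ x y : Fin m → K, (∀ P ∈ T, c (MvPolynomial.aeval x P) = c (MvPolynomial.aeval y P)) →
        (Structure.RelMap R x ↔ Structure.RelMap R y))
    (hdef : ∀ {β : Type} (t : (Language.ring.sum L).Term β) (i : σ),
      QFDefinable (Language.ring.sum L) {x : β → K | c (t.realize x) = i})
    (hpat : ∀ (k : ℕ) (F : Finset (Polynomial (MvPolynomial (Fin k) ℤ))),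
      ∃ T : Finset (MvPolynomial (Fin k) ℤ), ∀ φ ψ : MvPolynomial (Fin k) ℤ →+* K,
        (∀ t ∈ T, c (φ t) = c (ψ t)) → ∀ y, ∃ z, ∀ f ∈ F,
          c ((f.map φ).eval y) = c ((f.map ψ).eval z)) :
    HasQE (inferInstance : (Language.ring.sum L).Structure K) := by
  classical
  refine hasQE_of_exists _ _ fun k s hs => ?_
  obtain ⟨θ, hθ, hsθ⟩ := hs
  obtain ⟨F, hF⟩ := IsQF.exists_finset_mvPolynomial c hc hrel hθ
  obtain ⟨T, hT⟩ := hpat k (F.image (MvPolynomial.aeval (Fin.snoc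
    (fun i => Polynomial.C (MvPolynomial.X i)) Polynomial.X :
      Fin (k + 1) → Polynomial (MvPolynomial (Fin k) ℤ))))
  choose t ht using fun P : MvPolynomial (Fin k) ℤ => exists_term_realize_eq L K P
  have := Fintype.ofFinite σ
  refine QFDefinable.of_finset (T ×ˢ (Finset.univ : Finset σ))
    (fun q => {x | c ((t q.1).realize x) = q.2}) (fun q => hdef _ _) _ ?_
  rintro x y hxy ⟨a, ha⟩
  obtain ⟨b, hb⟩ := hT (MvPolynomial.aeval x : MvPolynomial (Fin k) ℤ →ₐ[ℤ] K).toRingHom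
    (MvPolynomial.aeval y : MvPolynomial (Fin k) ℤ →ₐ[ℤ] K).toRingHom (fun P hP => by
      have := hxy (P, c ((t P).realize x)) (Finset.mem_product.2 ⟨hP, Finset.mem_univ _⟩)
      simp only [Set.mem_ofPred_eq, true_iff] at this
      rw [ht, ht] at this
      exact this.symm) a
  refine ⟨b, ?_⟩
  rw [hsθ] at ha ⊢
  refine (hF _ _ _ fun P hP => ?_).1 ha
  have := hb _ (Finset.mem_image_of_mem _ hP)
  rwa [eval_map_aeval_snoc, eval_map_aeval_snoc] at this

end RelationalExpansion

/-! ### Quantifier elimination for algebraically closed fields and for the real field -/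

theorem hasQE_of_isAlgClosed (K : Type w) [Field K] [IsAlgClosed K]
    (S : FirstOrder.Language.empty.Structure K) : HasQE (ringExpansion K S) := by
  classical
  let := compatibleRingOfRing K
  refine hasQE_of_patterns (L := FirstOrder.Language.empty) (K := K) (fun a : K => decide (a = 0))
    (fun a b h => by simpa using h) (fun R => isEmptyElim R) ?_ ?_
  · intro β t i
    have h := QFDefinable.term_eq (M := K) t
      ((LHom.sumInl : Language.ring →ᴸ Language.ring.sum FirstOrder.Language.empty).onTerm 0)
    simp only [LHom.realize_onTerm, realize_zero] at h
    cases i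
    · simpa [Set.compl_def] using h.compl
    · simpa using h
  · intro k F
    -- For each candidate set `S` of vanishing polynomials, the remaining inequations are combined
    -- into one by taking a product.
    choose T hT using fun S : Finset (Polynomial (MvPolynomial (Fin k) ℤ)) =>
      exists_finset_zero_pattern K (∏ f ∈ F \ S, f) S.val
    refine ⟨F.powerset.biUnion T, fun φ ψ h y => ?_⟩
    set S := F.filter fun f => (f.map φ).eval y = 0 with hS
    obtain ⟨z, hz, hz'⟩ := hT S φ ψ (fun t ht => by
      simpa using h t (Finset.mem_biUnion.2 ⟨S, Finset.mem_powerset.2 (Finset.filter_subset _ _),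
        ht⟩)) ⟨y, fun f hf => (Finset.mem_filter.1 hf).2, by
          rw [Polynomial.map_prod, Polynomial.eval_prod, Finset.prod_ne_zero_iff]
          intro f hf h0
          rw [Finset.mem_sdiff] at hf
          exact hf.2 (Finset.mem_filter.2 ⟨hf.1, h0⟩)⟩
    refine ⟨z, fun f hf => ?_⟩
    rw [Polynomial.map_prod, Polynomial.eval_prod, Finset.prod_ne_zero_iff] at hz'
    by_cases h0 : (f.map φ).eval y = 0
    · simp [h0, hz f (Finset.mem_filter.2 ⟨hf, h0⟩)]
    · have := hz' f (Finset.mem_sdiff.2 ⟨hf, fun h => h0 (Finset.mem_filter.1 h).2⟩)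
      simp [h0, this]

theorem hasQE_real : HasQE (ringExpansion ℝ (FirstOrder.Language.orderStructure ℝ)) := by
  let := compatibleRingOfRing ℝ
  let := FirstOrder.Language.orderStructure ℝ
  refine hasQE_of_patterns (L := FirstOrder.Language.order) (K := ℝ) (fun a : ℝ => SignType.sign a)
    (fun a b h => by rw [← sign_eq_zero_iff, h, sign_eq_zero_iff]) ?_ ?_ ?_
  · intro m R
    cases R
    refine ⟨{MvPolynomial.X 0 - MvPolynomial.X 1}, fun x y h => ?_⟩
    replace h := h _ (Finset.mem_singleton_self _)
    simp only [map_sub, MvPolynomial.aeval_X] at h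
    change x 0 ≤ x 1 ↔ y 0 ≤ y 1
    rw [← sub_nonpos, ← sub_nonpos (a := y 0), ← sign_nonpos_iff, h, sign_nonpos_iff]
  · intro β t i
    have hle : ∀ t₁ t₂ : (Language.ring.sum FirstOrder.Language.order).Term β,
        QFDefinable (Language.ring.sum FirstOrder.Language.order)
          {x : β → ℝ | t₁.realize x ≤ t₂.realize x} := fun t₁ t₂ =>
      QFDefinable.rel (L := Language.ring.sum FirstOrder.Language.order) (M := ℝ)
        (Sum.inr orderRel.le) ![t₁, t₂]
    have h1 := hle t
      ((LHom.sumInl : Language.ring →ᴸ Language.ring.sum FirstOrder.Language.order).onTerm 0)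
    have h2 := hle
      ((LHom.sumInl : Language.ring →ᴸ Language.ring.sum FirstOrder.Language.order).onTerm 0) t
    simp only [LHom.realize_onTerm, realize_zero] at h1 h2
    cases i
    · convert h1.inter h2 using 1
      ext x
      exact sign_eq_zero_iff.trans le_antisymm_iff
    · convert h2.compl using 1
      ext x
      exact sign_eq_neg_one_iff.trans not_le.symm
    · convert h1.compl using 1
      ext x
      exact sign_eq_one_iff.trans not_le.symm
  · intro k F
    obtain ⟨T, hT⟩ := exists_finset_sign_table F.val
    refine ⟨T, fun φ ψ h y => ?_⟩
    obtain ⟨e, he⟩ := hT φ ψ h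
    exact ⟨e y, fun f hf => he f hf y⟩

/-! ### Quantifier-free formulas under substitution and language maps -/

theorem isQF_subst {L : FirstOrder.Language} {α β : Type*} {n : ℕ} {φ : L.BoundedFormula α n}
    (h : φ.IsQF) (f : α → L.Term β) : (φ.subst f).IsQF := by
  induction h with
  | falsum => exact .falsum
  | of_isAtomic h =>
    cases h with
    | equal t₁ t₂ => exact (BoundedFormula.IsAtomic.equal _ _).isQF
    | rel R ts => exact (BoundedFormula.IsAtomic.rel _ _).isQF
  | imp _ _ h₁ h₂ => exact h₁.imp h₂

theorem isQF_onBoundedFormula {L L' : FirstOrder.Language} (g : L →ᴸ L') {α : Type*} {n : ℕ}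
    {φ : L.BoundedFormula α n} (h : φ.IsQF) : (g.onBoundedFormula φ).IsQF := by
  induction h with
  | falsum => exact .falsum
  | of_isAtomic h =>
    cases h with
    | equal t₁ t₂ => exact (BoundedFormula.IsAtomic.equal _ _).isQF
    | rel R ts => exact (BoundedFormula.IsAtomic.rel _ _).isQF
  | imp _ _ h₁ h₂ => exact h₁.imp h₂

/-- Quantifier elimination passes along language maps in both directions that preserve the
interpretation of the symbols. -/
theorem hasQE_of_lhom {L L' : FirstOrder.Language} {M : Type*} [L.Structure M] [L'.Structure M]
    (f : L →ᴸ L') (g : L' →ᴸ L) [f.IsExpansionOn M] [g.IsExpansionOn M]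
    (h : HasQE (inferInstance : L.Structure M)) : HasQE (inferInstance : L'.Structure M) := by
  intro k φ
  obtain ⟨ψ, hψ, hφ⟩ := h k (g.onFormula φ)
  refine ⟨f.onFormula ψ, isQF_onBoundedFormula f hψ, fun x => ?_⟩
  rw [LHom.realize_onFormula, ← LHom.realize_onFormula g]
  exact hφ x

/-! ### Structures with coordinates in another structure -/

section Coordinates

variable {L₁ L₂ : FirstOrder.Language} {F M N : Type*} [L₁.Structure F] [L₂.Structure M]
  (co : M ≃ (N → F))

/-- The tuple of elements of `M` with the given coordinates. -/
def ofCoords {β : Type*} (w : β × N → F) (i : β) : M :=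
  co.symm fun q => w (i, q)

theorem ofCoords_coords {β : Type*} (A : β → M) : ofCoords co (fun q => co (A q.1) q.2) = A :=
  funext fun i => co.symm_apply_apply (A i)

theorem definableFun_coord_realize [Finite N]
    (hfun : ∀ {m : ℕ} (f : L₂.Functions m) (p : N), (∅ : Set F).DefinableFun L₁
      fun w : Fin m × N → F => co (Structure.funMap f (ofCoords co w)) p)
    {β : Type*} (t : L₂.Term β) (p : N) :
    (∅ : Set F).DefinableFun L₁ fun w : β × N → F => co (t.realize (ofCoords co w)) p := by
  induction t generalizing p with
  | var i =>
    simp only [Term.realize_var, ofCoords, Equiv.apply_symm_apply]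
    exact Set.DefinableFun.proj L₁
  | func f ts ih =>
    have := Set.DefinableFun.comp
      (g := fun (w : β × N → F) (q : Fin _ × N) => co ((ts q.1).realize (ofCoords co w)) q.2)
      (fun q => ih q.1 q.2) (hfun f p)
    have e : ∀ w : β × N → F, ofCoords co (fun q => co ((ts q.1).realize (ofCoords co w)) q.2) =
        fun i => (ts i).realize (ofCoords co w) := fun w =>
      ofCoords_coords co fun i => (ts i).realize (ofCoords co w)
    simpa only [e, Term.realize_func] using this

/-- One quantifier over `M` becomes a finite block of quantifiers over `F`, one for each index in
`N`. -/
theorem definable_realize_ofCoords [Finite N]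
    (hfun : ∀ {m : ℕ} (f : L₂.Functions m) (p : N), (∅ : Set F).DefinableFun L₁
      fun w : Fin m × N → F => co (Structure.funMap f (ofCoords co w)) p)
    (hrel : ∀ {m : ℕ} (R : L₂.Relations m), (∅ : Set F).Definable L₁
      {w : Fin m × N → F | Structure.RelMap R (ofCoords co w)})
    {α : Type*} {m : ℕ} (φ : L₂.BoundedFormula α m) :
    (∅ : Set F).Definable L₁ {w : (α ⊕ Fin m) × N → F |
      φ.Realize (ofCoords co w ∘ Sum.inl) (ofCoords co w ∘ Sum.inr)} := by
  have hterm : ∀ {m : ℕ} (t : L₂.Term (α ⊕ Fin m)) (w : (α ⊕ Fin m) × N → F),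
      t.realize (Sum.elim (ofCoords co w ∘ Sum.inl) (ofCoords co w ∘ Sum.inr)) =
        t.realize (ofCoords co w) := fun t w => by rw [Sum.elim_comp_inl_inr]
  induction φ with
  | falsum => exact Set.definable_empty
  | equal t₁ t₂ =>
    have := Set.definable_iInter_of_finite fun p =>
      (definableFun_coord_realize co hfun t₁ p).ofPred_eq (definableFun_coord_realize co hfun t₂ p)
    convert this using 1
    ext w
    simp only [Set.mem_iInter, Set.mem_ofPred_eq, BoundedFormula.Realize, hterm]
    rw [← co.injective.eq_iff, funext_iff]
  | @rel m l R ts =>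
    have := (hrel R).preimage_map (F := fun (w : (α ⊕ Fin m) × N → F) (q : Fin l × N) =>
      co ((ts q.1).realize (ofCoords co w)) q.2)
      (fun q => definableFun_coord_realize co hfun (ts q.1) q.2)
    convert this using 1
    ext w
    simp only [Set.mem_preimage, Set.mem_ofPred_eq, BoundedFormula.Realize, hterm]
    rw [ofCoords_coords co fun i => (ts i).realize (ofCoords co w)]
  | imp φ₁ φ₂ ih₁ ih₂ =>
    convert ih₁.compl.union ih₂ using 1
    ext w
    simp [imp_iff_not_or]
  | @all m φ ih =>
    have := Set.Definable.forall_of_finite (ih.preimage_comp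
      (fun q : (α ⊕ Fin (m + 1)) × N => Sum.elim (fun a => Sum.inl (Sum.inl a, q.2))
        (Fin.snoc (fun j => Sum.inl (Sum.inr j, q.2)) (Sum.inr q.2) :
          Fin (m + 1) → ((α ⊕ Fin m) × N) ⊕ N) q.1))
    convert this using 1
    ext w
    simp only [Set.mem_ofPred_eq, BoundedFormula.realize_all, Set.mem_preimage]
    rw [← co.symm.forall_congr_right]
    refine forall_congr' fun v => iff_of_eq (congrArg₂ _ rfl ?_)
    funext i
    refine Fin.lastCases ?_ (fun j => ?_) i
    · simp [ofCoords]
    · simp [ofCoords]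

/-- Quantifier elimination passes from `F` to a structure `M` with definable coordinates in `F`
that are given by terms of `M` with values in a copy of `F` in `M`. -/
theorem hasQE_of_coordinates [Finite N] [L₁.Structure M] (g : L₁ →ᴸ L₂) [g.IsExpansionOn M]
    (hfun : ∀ {m : ℕ} (f : L₂.Functions m) (p : N), (∅ : Set F).DefinableFun L₁
      fun w : Fin m × N → F => co (Structure.funMap f (ofCoords co w)) p)
    (hrel : ∀ {m : ℕ} (R : L₂.Relations m), (∅ : Set F).Definable L₁
      {w : Fin m × N → F | Structure.RelMap R (ofCoords co w)})
    (ι : F ↪[L₁] M) (τ : N → L₂.Term (Fin 1))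
    (hτ : ∀ p A, (τ p).realize (fun _ => A) = ι (co A p))
    (hF : HasQE (inferInstance : L₁.Structure F)) : HasQE (inferInstance : L₂.Structure M) := by
  intro k φ
  -- `HasQE` speaks of variables indexed by `Fin l`, so all coordinates of the tuple are numbered.
  obtain ⟨l, ⟨r⟩⟩ := Finite.exists_equiv_fin (Fin k × N)
  have hdef := (definable_realize_ofCoords co hfun hrel φ).preimage_comp
    (fun q : (Fin k ⊕ Fin 0) × N => r (Sum.elim id Fin.elim0 q.1, q.2))
  obtain ⟨θ, hθ⟩ := Set.empty_definable_iff.1 hdef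
  obtain ⟨ψ, hψ, hψθ⟩ := hF l θ
  refine ⟨BoundedFormula.subst (g.onFormula ψ)
    (fun j => (τ (r.symm j).2).relabel fun _ => (r.symm j).1),
    isQF_subst (isQF_onBoundedFormula g hψ) _, fun x => ?_⟩
  set w : Fin l → F := fun j => co (x (r.symm j).1) (r.symm j).2 with hw
  have h1 : θ.Realize w ↔ φ.Realize x := by
    have := Set.ext_iff.1 hθ w
    simp only [Set.mem_preimage, Set.mem_ofPred_eq] at this
    rw [← this, Formula.Realize]
    refine iff_of_eq (congrArg₂ _ ?_ (Subsingleton.elim _ _))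
    funext i
    simp [ofCoords, hw]
  have h2 : Formula.Realize (M := M) (BoundedFormula.subst (g.onFormula ψ)
      (fun j => (τ (r.symm j).2).relabel fun _ => (r.symm j).1)) x ↔
      (g.onFormula ψ).Realize (ι ∘ w) := by
    rw [Formula.Realize, BoundedFormula.realize_subst, Formula.Realize]
    refine iff_of_eq (congrArg₂ _ ?_ rfl)
    funext j
    rw [Term.realize_relabel]
    exact hτ _ _
  -- Truth of a quantifier-free formula is preserved in both directions by the embedding `ι`; this
  -- is where elimination in `F` is essential.
  rw [h2, LHom.realize_onFormula, ← h1, hψθ w, Formula.Realize, Formula.Realize,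
    ← hψ.realize_embedding ι]
  exact iff_of_eq (congrArg₂ _ rfl (Subsingleton.elim _ _))

end Coordinates

/-! ### Coordinates with respect to matrix units -/

namespace IsMatrixUnits

variable {F : Type w} [Field F] {n : ℕ} {e : Fin n → Fin n → Matrix (Fin n) (Fin n) F}

theorem mul_sum_mul (he : IsMatrixUnits e) (a : Fin n × Fin n → F) (i j k l : Fin n) :
    e i j * (∑ p, a p • e p.1 p.2) * e k l = a (j, k) • e i l := by
  rw [Finset.mul_sum, Finset.sum_mul, Finset.sum_eq_single (j, k)]
  · rw [mul_smul_comm, smul_mul_assoc, he.mul_same, he.mul_same]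
  · rintro ⟨s, t⟩ - hne
    rw [mul_smul_comm, smul_mul_assoc]
    by_cases hs : j = s
    · have ht : t ≠ k := fun h => hne (by rw [hs, h])
      rw [mul_assoc, he.mul_of_ne _ _ _ _ ht, mul_zero, smul_zero]
    · rw [he.mul_of_ne _ _ _ _ hs, zero_mul, smul_zero]
  · exact fun h => absurd (Finset.mem_univ _) h

theorem linearIndependent (he : IsMatrixUnits e) :
    LinearIndependent F fun p : Fin n × Fin n => e p.1 p.2 := by
  rw [Fintype.linearIndependent_iff]
  rintro a ha ⟨i, j⟩
  have := he.mul_sum_mul a i i j j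
  rw [ha, mul_zero, zero_mul, eq_comm, smul_eq_zero] at this
  exact this.resolve_right (he.ne_zero i j)

theorem eq_of_smul (he : IsMatrixUnits e) {i j : Fin n} {a b : F} (h : a • e i j = b • e i j) : a = b :=
  smul_left_injective F (he.ne_zero i j) h

/-- The matrix units as a basis of the matrix ring. -/
noncomputable def basis [NeZero n] (he : IsMatrixUnits e) :
    Module.Basis (Fin n × Fin n) F (Matrix (Fin n) (Fin n) F) :=
  basisOfLinearIndependentOfCardEqFinrank he.linearIndependent (by
    simp [Module.finrank_matrix])

variable [NeZero n]

theorem mul_mul (he : IsMatrixUnits e) (A : Matrix (Fin n) (Fin n) F) (i j k l : Fin n) :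
    e i j * A * e k l = he.basis.repr A (j, k) • e i l := by
  conv_lhs => rw [← he.basis.sum_repr A]
  simp only [basis, coe_basisOfLinearIndependentOfCardEqFinrank]
  exact he.mul_sum_mul _ i j k l

/-- The sum fixes every basis element under left multiplication, so it is a left identity. -/
theorem sum_diag (he : IsMatrixUnits e) : ∑ i, e i i = 1 := by
  have h : ∀ A, (∑ i, e i i) * A = A := by
    intro A
    rw [← he.basis.sum_repr A, Finset.mul_sum]
    refine Finset.sum_congr rfl fun p _ => ?_
    rw [mul_smul_comm]
    congr 1
    simp only [basis, coe_basisOfLinearIndependentOfCardEqFinrank]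
    rw [Finset.sum_mul, Finset.sum_eq_single p.1]
    · exact he.mul_same _ _ _
    · exact fun i _ hi => he.mul_of_ne _ _ _ _ hi
    · exact fun h => absurd (Finset.mem_univ _) h
  simpa using h 1

/-- Insert `1 = ∑ k, e k k` between the factors; coordinates then multiply like the entries of
ordinary matrices. -/
theorem repr_mul (he : IsMatrixUnits e) (A B : Matrix (Fin n) (Fin n) F) (i j : Fin n) :
    he.basis.repr (A * B) (i, j) = ∑ k, he.basis.repr A (i, k) * he.basis.repr B (k, j) := by
  refine he.eq_of_smul (i := i) (j := j) ?_
  rw [← he.mul_mul, Finset.sum_smul]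
  conv_lhs => rw [← mul_one A, ← he.sum_diag, Finset.mul_sum, Finset.sum_mul, Finset.mul_sum,
    Finset.sum_mul]
  refine Finset.sum_congr rfl fun k _ => ?_
  calc e i i * (A * e k k * B) * e j j = (e i i * A * e k k) * (e k k * B * e j j) := by
        conv_lhs => rw [← he.mul_same k k k]
        simp only [mul_assoc]
    _ = _ := by
        rw [he.mul_mul, he.mul_mul, smul_mul_smul_comm, he.mul_same]

theorem repr_unit (he : IsMatrixUnits e) (i j k l : Fin n) :
    he.basis.repr (e i j) (k, l) = if i = k ∧ j = l then 1 else 0 := by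
  have : e i j = he.basis (i, j) := by simp [basis]
  rw [this, he.basis.repr_self, Finsupp.single_apply]
  simp

theorem repr_scalar (he : IsMatrixUnits e) (a : F) (i j : Fin n) :
    he.basis.repr (Matrix.scalar (Fin n) a) (i, j) = if i = j then a else 0 := by
  refine he.eq_of_smul (i := i) (j := j) ?_
  rw [← he.mul_mul, Matrix.scalar_apply, ← Matrix.smul_one_eq_diagonal, mul_smul_comm, mul_one,
    smul_mul_assoc]
  split_ifs with h
  · subst h
    rw [he.mul_same]
  · rw [he.mul_of_ne _ _ _ _ h, smul_zero, zero_smul]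

theorem eq_scalar_iff (he : IsMatrixUnits e) (A : Matrix (Fin n) (Fin n) F) (a : F) :
    A = Matrix.scalar (Fin n) a ↔ ∀ p, he.basis.repr A p = if p.1 = p.2 then a else 0 := by
  constructor
  · rintro rfl ⟨i, j⟩
    exact he.repr_scalar a i j
  · intro h
    refine he.basis.repr.injective (Finsupp.ext fun p => ?_)
    rw [h p, he.repr_scalar]

/-- Every summand is the same coordinate times `e t t`, and the diagonal units add up to `1`. This
expresses the coordinate by a term in `A` and the matrix units. -/
theorem sum_mul_mul (he : IsMatrixUnits e) (A : Matrix (Fin n) (Fin n) F) (i j : Fin n) :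
    ∑ t, e t i * A * e j t = Matrix.scalar (Fin n) (he.basis.repr A (i, j)) := by
  simp only [he.mul_mul]
  rw [← Finset.smul_sum, he.sum_diag, Matrix.scalar_apply, Matrix.smul_one_eq_diagonal]

end IsMatrixUnits

/-! ### Definable functions in expansions of a ring -/

section DefinableFun

variable {L : FirstOrder.Language.{u, v}} {R : Type w} [Ring R] [CompatibleRing R] [L.Structure R]
  {α : Type*}

theorem definableFun_zero : (∅ : Set R).DefinableFun (Language.ring.sum L) fun _ : α → R => 0 := by
  have := (LHom.sumInl.onTerm (0 : Language.ring.Term α) :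
    (Language.ring.sum L).Term α).definableFun_realize (M := R)
  simpa [funext_iff, LHom.realize_onTerm] using this

theorem definableFun_one : (∅ : Set R).DefinableFun (Language.ring.sum L) fun _ : α → R => 1 := by
  have := (LHom.sumInl.onTerm (1 : Language.ring.Term α) :
    (Language.ring.sum L).Term α).definableFun_realize (M := R)
  simpa [funext_iff, LHom.realize_onTerm] using this

variable {f g : (α → R) → R}

theorem definableFun_neg (hf : (∅ : Set R).DefinableFun (Language.ring.sum L) f) :
    (∅ : Set R).DefinableFun (Language.ring.sum L) fun x => -f x := by
  have := (LHom.sumInl.onTerm (-(Term.var 0) : Language.ring.Term (Fin 1)) :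
    (Language.ring.sum L).Term (Fin 1)).definableFun_realize (M := R)
  have h := Set.DefinableFun.comp (g := fun x => ![f x]) (fun i => by fin_cases i; exact hf) this
  simpa [LHom.realize_onTerm] using h

theorem definableFun_add (hf : (∅ : Set R).DefinableFun (Language.ring.sum L) f)
    (hg : (∅ : Set R).DefinableFun (Language.ring.sum L) g) :
    (∅ : Set R).DefinableFun (Language.ring.sum L) fun x => f x + g x := by
  have := (LHom.sumInl.onTerm (Term.var 0 + Term.var 1 : Language.ring.Term (Fin 2)) :
    (Language.ring.sum L).Term (Fin 2)).definableFun_realize (M := R)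
  have h := Set.DefinableFun.comp (g := fun x => ![f x, g x])
    (fun i => by fin_cases i; exacts [hf, hg]) this
  simpa [LHom.realize_onTerm] using h

theorem definableFun_mul (hf : (∅ : Set R).DefinableFun (Language.ring.sum L) f)
    (hg : (∅ : Set R).DefinableFun (Language.ring.sum L) g) :
    (∅ : Set R).DefinableFun (Language.ring.sum L) fun x => f x * g x := by
  have := (LHom.sumInl.onTerm (Term.var 0 * Term.var 1 : Language.ring.Term (Fin 2)) :
    (Language.ring.sum L).Term (Fin 2)).definableFun_realize (M := R)
  have h := Set.DefinableFun.comp (g := fun x => ![f x, g x])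
    (fun i => by fin_cases i; exacts [hf, hg]) this
  simpa [LHom.realize_onTerm] using h

theorem definableFun_sum {ι : Type*} (s : Finset ι) {f : ι → (α → R) → R}
    (hf : ∀ i, (∅ : Set R).DefinableFun (Language.ring.sum L) (f i)) :
    (∅ : Set R).DefinableFun (Language.ring.sum L) fun x => ∑ i ∈ s, f i x := by
  classical
  induction s using Finset.induction_on with
  | empty => simpa using definableFun_zero
  | insert i s hi ih =>
    simp only [Finset.sum_insert hi]
    exact definableFun_add (hf i) ih

end DefinableFun

/-! ### Quantifier elimination for matrix rings -/

section Matrix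

variable {L : FirstOrder.Language.{u, v}} {F : Type w} [Field F] {n : ℕ}

theorem funMap_centerStructure_of_not (S : L.Structure F) {k : ℕ} (f : L.Functions k)
    {A : Fin k → Matrix (Fin n) (Fin n) F} (h : ¬ ∃ a, IsCentralTuple A a) :
    (centerStructure S n).funMap f A = 0 :=
  dif_neg h

variable [NeZero n]

theorem IsCentralTuple.unique {k : ℕ} {A : Fin k → Matrix (Fin n) (Fin n) F} {a b : Fin k → F}
    (ha : IsCentralTuple A a) (hb : IsCentralTuple A b) : a = b :=
  funext fun i => Matrix.scalar_inj.1 ((ha i).symm.trans (hb i))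

theorem funMap_centerStructure (S : L.Structure F) {k : ℕ} (f : L.Functions k)
    {A : Fin k → Matrix (Fin n) (Fin n) F} {a : Fin k → F} (ha : IsCentralTuple A a) :
    (centerStructure S n).funMap f A = Matrix.scalar (Fin n) (S.funMap f a) := by
  have h : ∃ a, IsCentralTuple A a := ⟨a, ha⟩
  exact (dif_pos h).trans (by rw [h.choose_spec.unique ha])

theorem relMap_centerStructure (S : L.Structure F) {k : ℕ} (R : L.Relations k)
    {A : Fin k → Matrix (Fin n) (Fin n) F} {a : Fin k → F} (ha : IsCentralTuple A a) :
    (centerStructure S n).RelMap R A ↔ S.RelMap R a :=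
  ⟨fun ⟨_, hb, h⟩ => hb.unique ha ▸ h, fun h => ⟨a, ha, h⟩⟩

variable (n) in
/-- The embedding of a field with additional structure into its matrix ring. -/
def scalarEmbedding (S : L.Structure F) :
    letI := ringExpansion F S
    letI := matrixExpansion S n
    F ↪[Language.ring.sum L] Matrix (Fin n) (Fin n) F :=
  letI := ringExpansion F S
  letI := matrixExpansion S n
  { toFun := fun a => Matrix.scalar (Fin n) a
    inj' := fun _ _ h => Matrix.scalar_inj.1 h
    map_fun' := by
      rintro k (f | f) x
      · cases f with
        | add => exact map_add (Matrix.scalar (Fin n)) (x 0) (x 1)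
        | mul => exact map_mul (Matrix.scalar (Fin n)) (x 0) (x 1)
        | neg => exact map_neg (Matrix.scalar (Fin n)) (x 0)
        | zero => exact map_zero (Matrix.scalar (Fin n))
        | one => exact map_one (Matrix.scalar (Fin n))
      · exact (funMap_centerStructure S f fun _ => rfl).symm
    map_rel' := by
      rintro k (R | R) x
      · exact isEmptyElim R
      · exact relMap_centerStructure S R fun _ => rfl }

variable {e : Fin n → Fin n → Matrix (Fin n) (Fin n) F} (he : IsMatrixUnits e)

theorem isCentralTuple_ofCoords_iff {k : ℕ} (w : Fin k × (Fin n × Fin n) → F) (a : Fin k → F) :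
    IsCentralTuple (ofCoords he.basis.equivFun.toEquiv w) a ↔
      ∀ i p, w (i, p) = if p.1 = p.2 then a i else 0 := by
  refine forall_congr' fun i => ?_
  rw [he.eq_scalar_iff]
  refine forall_congr' fun p => ?_
  rw [← Module.Basis.equivFun_apply]
  exact iff_of_eq (congrArg (· = _)
    (congrFun (he.basis.equivFun.toEquiv.apply_symm_apply fun q => w (i, q)) p))

/-- The coordinates of a tuple of central matrices. -/
def IsCentralCoords {k : ℕ} (w : Fin k × (Fin n × Fin n) → F) : Prop :=
  ∀ i p, w (i, p) = if p.1 = p.2 then w (i, (0, 0)) else 0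

theorem exists_isCentralTuple_iff {k : ℕ} (w : Fin k × (Fin n × Fin n) → F) :
    (∃ a, IsCentralTuple (ofCoords he.basis.equivFun.toEquiv w) a) ↔ IsCentralCoords w := by
  simp only [isCentralTuple_ofCoords_iff]
  constructor
  · rintro ⟨a, ha⟩ i p
    rw [ha i p, ha i (0, 0), if_pos rfl]
  · exact fun h => ⟨fun i => w (i, (0, 0)), h⟩

theorem IsCentralCoords.isCentralTuple {k : ℕ} {w : Fin k × (Fin n × Fin n) → F}
    (h : IsCentralCoords w) :
    IsCentralTuple (ofCoords he.basis.equivFun.toEquiv w) fun i => w (i, (0, 0)) :=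
  (isCentralTuple_ofCoords_iff he w _).2 h

theorem definable_isCentralCoords (S : L.Structure F) (k : ℕ) :
    letI := ringExpansion F S
    (∅ : Set F).Definable (Language.ring.sum L)
      (Set.ofPred fun w : Fin k × (Fin n × Fin n) → F => IsCentralCoords w) := by
  let := compatibleRingOfRing F
  have := Set.definable_iInter_of_finite (A := (∅ : Set F)) (L := Language.ring.sum L)
    fun i : Fin k => Set.definable_iInter_of_finite fun p : Fin n × Fin n =>
      Set.DefinableFun.ofPred_eq (f := fun w : Fin k × (Fin n × Fin n) → F => w (i, p))
        (g := fun w => if p.1 = p.2 then w (i, (0, 0)) else 0)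
        (Set.DefinableFun.proj _) (by
          split_ifs
          · exact Set.DefinableFun.proj _
          · exact definableFun_zero)
  convert this using 1
  ext w
  simp [IsCentralCoords]

/-- The ring operations have the usual matrix formulas in coordinates, and a named unit has
coordinates `0` and `1`. A new function symbol is evaluated on the `(0, 0)` coordinates if the tuple
is central, and gives `0` otherwise. -/
theorem definableFun_coord_funMap (S : L.Structure F) {k : ℕ}
    (f : ((Language.ring.sum L).withConstants (Fin n × Fin n)).Functions k) (p : Fin n × Fin n) :
    letI := ringExpansion F S
    letI := nameConstants (matrixExpansion S n) e
    (∅ : Set F).DefinableFun (Language.ring.sum L) fun w : Fin k × (Fin n × Fin n) → F =>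
      he.basis.equivFun.toEquiv (Structure.funMap f (ofCoords he.basis.equivFun.toEquiv w)) p := by
  classical
  let := compatibleRingOfRing F
  set co := he.basis.equivFun.toEquiv with hco
  have hcoord : ∀ (w : Fin k × (Fin n × Fin n) → F) i q,
      he.basis.equivFun (ofCoords co w i) q = w (i, q) := fun w i q =>
    congrFun (co.apply_symm_apply fun q => w (i, q)) q
  rcases f with (f | f) | c
  · cases f with
    | add =>
      have h : (fun w : Fin 2 × (Fin n × Fin n) → F => he.basis.equivFun
          (ofCoords co w 0 + ofCoords co w 1) p) = fun w => w (0, p) + w (1, p) := by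
        funext w
        rw [map_add, Pi.add_apply, hcoord, hcoord]
      exact h ▸ definableFun_add (Set.DefinableFun.proj _) (Set.DefinableFun.proj _)
    | mul =>
      have h : (fun w : Fin 2 × (Fin n × Fin n) → F => he.basis.equivFun
          (ofCoords co w 0 * ofCoords co w 1) p) =
            fun w => ∑ k, w (0, (p.1, k)) * w (1, (k, p.2)) := by
        funext w
        rw [Module.Basis.equivFun_apply, he.repr_mul]
        simp only [← Module.Basis.equivFun_apply, hcoord]
      exact h ▸ definableFun_sum _ fun k =>
        definableFun_mul (Set.DefinableFun.proj _) (Set.DefinableFun.proj _)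
    | neg =>
      have h : (fun w : Fin 1 × (Fin n × Fin n) → F => he.basis.equivFun
          (-ofCoords co w 0) p) = fun w => -w (0, p) := by
        funext w
        rw [map_neg, Pi.neg_apply, hcoord]
      exact h ▸ definableFun_neg (Set.DefinableFun.proj _)
    | zero =>
      have h : (fun _ : Fin 0 × (Fin n × Fin n) → F => he.basis.equivFun 0 p) =
          fun _ => 0 := by
        funext w
        rw [map_zero, Pi.zero_apply]
      exact h ▸ definableFun_zero
    | one =>
      have h : (fun _ : Fin 0 × (Fin n × Fin n) → F => he.basis.equivFun 1 p) =
          fun _ => if p.1 = p.2 then 1 else 0 := by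
        funext w
        rw [← map_one (Matrix.scalar (Fin n)), Module.Basis.equivFun_apply, he.repr_scalar]
      refine h ▸ ?_
      split_ifs
      · exact definableFun_one
      · exact definableFun_zero
  · have h : (fun w : Fin k × (Fin n × Fin n) → F => he.basis.equivFun
        ((centerStructure S n).funMap f (ofCoords co w)) p) = fun w => if IsCentralCoords w then
          (if p.1 = p.2 then S.funMap f fun i => w (i, (0, 0)) else 0) else 0 := by
      funext w
      by_cases hw : IsCentralCoords w
      · rw [if_pos hw, funMap_centerStructure S f (hw.isCentralTuple he),
          Module.Basis.equivFun_apply, he.repr_scalar]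
      · rw [if_neg hw, funMap_centerStructure_of_not S f
          (by rwa [hco, exists_isCentralTuple_iff he]), map_zero, Pi.zero_apply]
    refine h ▸ Set.DefinableFun.ite (definable_isCentralCoords S k) ?_ definableFun_zero
    split_ifs
    · exact Set.DefinableFun.comp (L := Language.ring.sum L)
        (g := fun (w : Fin k × (Fin n × Fin n) → F) i => w (i, (0, 0)))
        (fun i => Set.DefinableFun.proj _)
        (Set.DefinableFun.fun_symbol (L := Language.ring.sum L) (Sum.inr f))
    · exact definableFun_zero
  · cases k with
    | zero =>
      have h : (fun _ : Fin 0 × (Fin n × Fin n) → F => he.basis.equivFun (e c.1 c.2) p) =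
          fun _ => if c.1 = p.1 ∧ c.2 = p.2 then 1 else 0 := by
        funext w
        rw [Module.Basis.equivFun_apply, he.repr_unit]
      refine h ▸ ?_
      split_ifs
      · exact definableFun_one
      · exact definableFun_zero
    | succ k => exact isEmptyElim c

theorem definable_relMap_ofCoords (S : L.Structure F) {k : ℕ}
    (R : ((Language.ring.sum L).withConstants (Fin n × Fin n)).Relations k) :
    letI := ringExpansion F S
    letI := nameConstants (matrixExpansion S n) e
    (∅ : Set F).Definable (Language.ring.sum L) {w : Fin k × (Fin n × Fin n) → F |
      Structure.RelMap R (ofCoords he.basis.equivFun.toEquiv w)} := by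
  let := ringExpansion F S
  rcases R with (R | R) | R
  · exact isEmptyElim R
  · have h : {w : Fin k × (Fin n × Fin n) → F | (centerStructure S n).RelMap R
        (ofCoords he.basis.equivFun.toEquiv w)} = (Set.ofPred fun w => IsCentralCoords w) ∩
          (fun w i => w (i, (0, 0))) ⁻¹' {x : Fin k → F | S.RelMap R x} := by
      ext w
      constructor
      · intro hw
        have hc : IsCentralCoords w := by
          obtain ⟨a, ha, -⟩ := hw
          exact (exists_isCentralTuple_iff he w).1 ⟨a, ha⟩
        exact ⟨hc, (relMap_centerStructure S R (hc.isCentralTuple he)).1 hw⟩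
      · rintro ⟨hc, hw⟩
        exact (relMap_centerStructure S R (IsCentralCoords.isCentralTuple he hc)).2 hw
    have hR : (∅ : Set F).Definable (Language.ring.sum L) {x : Fin k → F | S.RelMap R x} :=
      Set.empty_definable_iff.2 ⟨Relations.formula (L := Language.ring.sum L) (Sum.inr R) Term.var,
        rfl⟩
    exact h ▸ (definable_isCentralCoords S k).inter
      (hR.preimage_comp fun i : Fin k => (i, ((0 : Fin n), (0 : Fin n))))
  · exact isEmptyElim R

/-- Finite sums of terms. -/
theorem exists_term_realize_sum {L' : FirstOrder.Language} {R α ι : Type*} [Ring R]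
    [CompatibleRing R] [L'.Structure R] (g : Language.ring →ᴸ L') [g.IsExpansionOn R]
    (s : Finset ι) (t : ι → L'.Term α) :
    ∃ τ : L'.Term α, ∀ x : α → R, τ.realize x = ∑ i ∈ s, (t i).realize x := by
  classical
  induction s using Finset.induction_on with
  | empty => exact ⟨g.onTerm 0, fun x => by simp⟩
  | insert i s hi ih =>
    obtain ⟨τ, hτ⟩ := ih
    refine ⟨(g.onTerm (Term.var 0 + Term.var 1 : Language.ring.Term (Fin 2))).subst ![t i, τ],
      fun x => ?_⟩
    simp [Finset.sum_insert hi, Term.realize_subst, hτ]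

theorem exists_term_coord (S : L.Structure F) (p : Fin n × Fin n) :
    letI := nameConstants (matrixExpansion S n) e
    ∃ τ : ((Language.ring.sum L).withConstants (Fin n × Fin n)).Term (Fin 1),
      ∀ A : Matrix (Fin n) (Fin n) F, τ.realize (fun _ => A) =
        Matrix.scalar (Fin n) (he.basis.equivFun.toEquiv A p) := by
  let := compatibleRingOfRing (Matrix (Fin n) (Fin n) F)
  let := nameConstants (matrixExpansion S n) e
  let g : Language.ring →ᴸ (Language.ring.sum L).withConstants (Fin n × Fin n) :=
    LHom.sumInl.comp LHom.sumInl
  have : g.IsExpansionOn (Matrix (Fin n) (Fin n) F) := ⟨fun _ _ => rfl, fun _ _ => rfl⟩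
  let con : Fin n × Fin n → ((Language.ring.sum L).withConstants (Fin n × Fin n)).Term (Fin 1) :=
    fun c => ((Language.ring.sum L).con c).term
  have hcon : ∀ c (x : Fin 1 → Matrix (Fin n) (Fin n) F), (con c).realize x = e c.1 c.2 :=
    fun c x => rfl
  obtain ⟨τ, hτ⟩ := exists_term_realize_sum (R := Matrix (Fin n) (Fin n) F) g Finset.univ fun t =>
    (g.onTerm (Term.var 0 * Term.var 1 * Term.var 2 : Language.ring.Term (Fin 3))).subst
      ![con (t, p.1), Term.var 0, con (p.2, t)]
  refine ⟨τ, fun A => ?_⟩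
  rw [hτ]
  refine Eq.trans ?_ (he.sum_mul_mul A p.1 p.2)
  refine Finset.sum_congr rfl fun t _ => ?_
  simp [Term.realize_subst, hcon]

theorem hasQE_matrix (he : IsMatrixUnits e) (S : L.Structure F) (hF : HasQE (ringExpansion F S)) :
    HasQE (nameConstants (matrixExpansion S n) e) := by
  let := ringExpansion F S
  let := matrixExpansion S n
  let := nameConstants (matrixExpansion S n) e
  choose τ hτ using fun p => exists_term_coord he S p
  have : ((Language.ring.sum L).lhomWithConstants (Fin n × Fin n)).IsExpansionOn
      (Matrix (Fin n) (Fin n) F) := ⟨fun _ _ => rfl, fun _ _ => rfl⟩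
  exact hasQE_of_coordinates he.basis.equivFun.toEquiv
    ((Language.ring.sum L).lhomWithConstants (Fin n × Fin n))
    (definableFun_coord_funMap he S) (definable_relMap_ofCoords he S) (scalarEmbedding n S) τ hτ hF

end Matrix

theorem isMatrixUnits_stdUnits (F : Type w) [Field F] (n : ℕ) :
    IsMatrixUnits (stdUnits F n) where
  mul_same i j t := by simp
  mul_of_ne i j s t h := by simp [h]
  ne_zero i j h := one_ne_zero (α := F) (by simpa using congrFun (congrFun h i) j)

theorem hasQE_matrix_of_isAlgClosed (K : Type w) [Field K] [IsAlgClosed K] (n : ℕ) [NeZero n] :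
    HasQE (nameConstants (ringStructure (Matrix (Fin n) (Fin n) K)) (stdUnits K n)) := by
  have h := hasQE_matrix (isMatrixUnits_stdUnits K n) _
    (hasQE_of_isAlgClosed K FirstOrder.Language.emptyStructure)
  let := ringStructure (Matrix (Fin n) (Fin n) K)
  let := nameConstants (matrixExpansion
    (FirstOrder.Language.emptyStructure : FirstOrder.Language.empty.Structure K) n) (stdUnits K n)
  let := nameConstants (ringStructure (Matrix (Fin n) (Fin n) K)) (stdUnits K n)
  -- The pure ring language and its sum with the empty language differ only formally; `f` and `g`
  -- translate between them.
  let f : (Language.ring.sum FirstOrder.Language.empty).withConstants (Fin n × Fin n) →ᴸ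
      Language.ring.withConstants (Fin n × Fin n) :=
    LHom.sumMap (LHom.sumElim (LHom.id _) (LHom.ofIsEmpty _ _)) (LHom.id _)
  let g : Language.ring.withConstants (Fin n × Fin n) →ᴸ
      (Language.ring.sum FirstOrder.Language.empty).withConstants (Fin n × Fin n) :=
    LHom.sumMap LHom.sumInl (LHom.id _)
  have : f.IsExpansionOn (Matrix (Fin n) (Fin n) K) := by
    constructor
    · rintro k ((s | s) | s) x
      · rfl
      · exact isEmptyElim s
      · rfl
    · rintro k ((s | s) | s) x
      · rfl
      · exact isEmptyElim s
      · rfl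
  have : g.IsExpansionOn (Matrix (Fin n) (Fin n) K) := by
    constructor
    · rintro k (s | s) x <;> rfl
    · rintro k (s | s) x <;> rfl
  exact hasQE_of_lhom f g h

end MatrixQE

theorem mainTheorem5 (n : ℕ) (hn : 0 < n) :
    (∀ (L : FirstOrder.Language.{u, v}) (F : Type w) [Field F] (S : L.Structure F),
      MatrixQE.HasQE (MatrixQE.ringExpansion F S) →
      ∀ e : Fin n → Fin n → Matrix (Fin n) (Fin n) F, MatrixQE.IsMatrixUnits e →
        MatrixQE.HasQE (MatrixQE.nameConstants (MatrixQE.matrixExpansion S n) e)) ∧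
    MatrixQE.HasQE (MatrixQE.nameConstants
      (MatrixQE.ringStructure (Matrix (Fin n) (Fin n) ℂ)) (MatrixQE.stdUnits ℂ n)) ∧
    MatrixQE.HasQE (MatrixQE.nameConstants
      (MatrixQE.matrixExpansion (FirstOrder.Language.orderStructure ℝ) n)
      (MatrixQE.stdUnits ℝ n)) := by
  have : NeZero n := ⟨hn.ne'⟩
  exact ⟨fun L F _ S hF e he => MatrixQE.hasQE_matrix he S hF,
    MatrixQE.hasQE_matrix_of_isAlgClosed ℂ n,
    MatrixQE.hasQE_matrix (MatrixQE.isMatrixUnits_stdUnits ℝ n) _ MatrixQE.hasQE_real⟩
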